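/- Let $Y$ be a geometrically integral projective curve over a finite field $\mathbb{F}_q$, let $u\colon C\to Y$ be its normalization, and let $\overline{\mathbb{F}}_q$ be an algebraic closure of $\mathbb{F}_q$. For a projective scheme $X$ over $\mathbb{F}_q$ let $Z_X(t)=\exp\bigl(\sum_{n\ge 1}\sharp X(\mathbb{F}_{q^n})\,t^n/n\bigr)\in\mathbb{Q}[[t]]$ be its zeta function. Let $\mathrm{Sing}(Y)(\overline{\mathbb{F}}_q)$ be the set of $\overline{\mathbb{F}}_q$-points of $Y$ at which $Y$ is singular, for $P\in Y(\overline{\mathbb{F}}_q)$ let $u^{-1}(P)$ be the set of points of $C(\overline{\mathbb{F}}_q)$ mapped to $P$, and put $$\Delta_Y=\sharp\, u^{-1}\bigl(\mathrm{Sing}(Y)(\overline{\mathbb{F}}_q)\bigr)-\sharp\,\mathrm{Sing}(Y)(\overline{\mathbb{F}}_q).$$ Then $Z_Y(t)/Z_C(t)$ is a polynomial of degree $\Delta_Y$, and all its inverse roots (the $\beta\in\mathbb{C}\setminus\{0\}$ such that $\beta^{-1}$ is a root) are equal to $-1$ if and only if every $P\in\mathrm{Sing}(Y)(\overline{\mathbb{F}}_q)$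 satisfies one of the following two conditions: (a) $\sharp\, u^{-1}(P)=1$; (b) $P\in Y(\mathbb{F}_q)$, and $u^{-1}(P)$ consists of exactly two points, which lie in $C(\mathbb{F}_{q^2})\setminus C(\mathbb{F}_q)$ and are exchanged by the $q$-Frobenius. -/

import Mathlib

open CategoryTheory AlgebraicGeometry

universe u

noncomputable section

namespace CurveZeta

attribute [local instance] MvPolynomial.gradedAlgebra

/-- Projective `n`-space over `k`: `Proj k[x₀, …, xₙ]`. -/
def projectiveSpace (k : Type u) [Field k] (n : ℕ) : Scheme.{u} :=
  Proj (MvPolynomial.homogeneousSubmodule (Fin (n + 1)) k)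

/-- The structure morphism `ℙⁿ ⟶ Spec k`. -/
def projectiveSpaceToSpec (k : Type u) [Field k] (n : ℕ) :
    projectiveSpace k n ⟶ Spec (CommRingCat.of k) :=
  Proj.toSpecZero (MvPolynomial.homogeneousSubmodule (Fin (n + 1)) k) ≫
    Spec.map (CommRingCat.ofHom
      (algebraMap k (MvPolynomial.homogeneousSubmodule (Fin (n + 1)) k 0)))

/-- `X` is projective over `k`: it is isomorphic over `k` to a closed subscheme of some `ℙⁿ`. -/
def IsProjective {k : Type u} [Field k] {X : Scheme.{u}} (s : X ⟶ Spec (CommRingCat.of k)) :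
    Prop :=
  ∃ (n : ℕ) (i : X ⟶ projectiveSpace k n),
    IsClosedImmersion i ∧ i ≫ projectiveSpaceToSpec k n = s

/-- `u : C ⟶ Y` is the normalization of the integral scheme `Y`: `C` is integral and normal and
`u` is integral and birational (dominant and an isomorphism on function fields, that is, on the
local rings at the generic points). -/
structure IsNormalization {C Y : Scheme.{u}} (u : C ⟶ Y) : Prop where
  isIntegral : IsIntegral C
  isIntegrallyClosed_stalk : ∀ x : C, IsIntegrallyClosed (C.presheaf.stalk x)
  isIntegralHom : IsIntegralHom u
  isDominant : IsDominant u
  isIso_stalkMap_genericPoint : IsIso (u.stalkMap (genericPoint C))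

section Points

variable {k : Type u} [Field k] {X C Y : Scheme.{u}}

/-- The set `X(A)` of `A`-valued points over `k` of the `k`-scheme `s : X ⟶ Spec k`. -/
def Points (s : X ⟶ Spec (CommRingCat.of k)) (A : Type u) [CommRing A] [Algebra k A] : Type u :=
  {x : Spec (CommRingCat.of A) ⟶ X //
    x ≫ s = Spec.map (CommRingCat.ofHom (algebraMap k A))}

/-- The map `X(A) → X(B)` induced by a homomorphism of `k`-algebras `A → B`. -/
def Points.map {s : X ⟶ Spec (CommRingCat.of k)} {A B : Type u} [CommRing A] [Algebra k A]
    [CommRing B] [Algebra k B] (f : A →ₐ[k] B) (x : Points s A) : Points s B :=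
  ⟨Spec.map (CommRingCat.ofHom f.toRingHom) ≫ x.1, by
    rw [Category.assoc, x.2, ← Spec.map_comp, ← CommRingCat.ofHom_comp]
    congr 2
    exact f.comp_algebraMap⟩

/-- The map `C(A) → Y(A)` induced by a morphism `u : C ⟶ Y` of `k`-schemes. -/
def Points.push (u : C ⟶ Y) {s : Y ⟶ Spec (CommRingCat.of k)} {A : Type u} [CommRing A]
    [Algebra k A] (x : Points (u ≫ s) A) : Points s A :=
  ⟨x.1 ≫ u, by rw [Category.assoc]; exact x.2⟩

/-- The point of the underlying space of `X` at which a field-valued point is located. -/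
def Points.point {s : X ⟶ Spec (CommRingCat.of k)} {K : Type u} [Field K] [Algebra k K]
    (x : Points s K) : X :=
  x.1 (IsLocalRing.closedPoint K)

/-- `Sing(X)(K)`: the `K`-points of `X` located at points whose local ring is not regular. -/
def singularPoints (s : X ⟶ Spec (CommRingCat.of k)) (K : Type u) [Field K] [Algebra k K] :
    Set (Points s K) :=
  {P | ¬ IsRegularLocalRing (X.presheaf.stalk P.point)}

/-- The set `u⁻¹(P)` of `K`-points of `C` above the `K`-point `P` of `Y`. -/
def fibre (u : C ⟶ Y) {s : Y ⟶ Spec (CommRingCat.of k)} {K : Type u} [Field K] [Algebra k K]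
    (P : Points s K) : Set (Points (u ≫ s) K) :=
  {Q | Q.push u = P}

/-- `Δ_Y = # u⁻¹(Sing(Y)(K)) - # Sing(Y)(K)`; here `K` is an algebraic closure of `k`. -/
def delta (u : C ⟶ Y) (s : Y ⟶ Spec (CommRingCat.of k)) (K : Type u) [Field K] [Algebra k K] :
    ℤ :=
  ((Points.push u ⁻¹' singularPoints s K : Set (Points (u ≫ s) K)).ncard : ℤ) -
    ((singularPoints s K).ncard : ℤ)

end Points

section FiniteField

variable (k : Type u) [Field k] [Fintype k] (K : Type u) [Field K] [Algebra k K]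

/-- For `k` with `q` elements, `K` an algebraic closure of `k` and `n ≥ 1`, the subfield
`𝔽_{qⁿ} = {x | x ^ (q ^ n) = x}` of `K`. -/
def finiteSubfield (n : ℕ) : IntermediateField k K where
  carrier := {x | (FiniteField.frobeniusAlgHom k K ^ n) x = x}
  mul_mem' {a b} ha hb := by
    simp only [Set.mem_ofPred_eq] at ha hb ⊢
    rw [map_mul, ha, hb]
  add_mem' {a b} ha hb := by
    simp only [Set.mem_ofPred_eq] at ha hb ⊢
    rw [map_add, ha, hb]
  algebraMap_mem' r := (FiniteField.frobeniusAlgHom k K ^ n).commutes r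
  inv_mem' a ha := by
    simp only [Set.mem_ofPred_eq] at ha ⊢
    rw [map_inv₀, ha]

theorem mem_finiteSubfield (n : ℕ) (x : K) :
    x ∈ finiteSubfield k K n ↔ x ^ (Fintype.card k ^ n) = x := by
  change (FiniteField.frobeniusAlgHom k K ^ n) x = x ↔ _
  rw [AlgHom.coe_pow, FiniteField.coe_frobeniusAlgHom, pow_iterate]

variable {k} {X : Scheme.{u}}

/-- The number `# X(𝔽_{qⁿ})`. -/
def numPoints (s : X ⟶ Spec (CommRingCat.of k)) (n : ℕ) : ℕ :=
  Nat.card (Points s (finiteSubfield k K n))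

/-- The zeta function `Z_X(t) = exp (∑_{n ≥ 1} # X(𝔽_{qⁿ}) tⁿ / n)`, as a formal power series.
(The coefficient with `n = 0` inside the exponential is `0` because of the division by `n`.) -/
def zeta (s : X ⟶ Spec (CommRingCat.of k)) : PowerSeries ℚ :=
  (PowerSeries.exp ℚ).subst
    (PowerSeries.mk fun n : ℕ => (numPoints K s n : ℚ) / (n : ℚ))

variable {K}

/-- The `q`-Frobenius on `X(K)`. -/
def frobenius {s : X ⟶ Spec (CommRingCat.of k)} (P : Points s K) : Points s K :=
  P.map (FiniteField.frobeniusAlgHom k K)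

/-- The `K`-point `P` belongs to the subset `X(𝔽_{qⁿ})` of `X(K)`. -/
def IsDefinedOver {s : X ⟶ Spec (CommRingCat.of k)} (n : ℕ) (P : Points s K) : Prop :=
  ∃ x : Points s (finiteSubfield k K n), x.map (finiteSubfield k K n).val = P

end FiniteField

/-- `β` is an inverse root (reciprocal root) of the polynomial `L`. -/
def IsInverseRoot (L : Polynomial ℚ) (β : ℂ) : Prop :=
  β ≠ 0 ∧ Polynomial.aeval β⁻¹ L = 0

end CurveZeta

end

/-! Write `S` for the singular `K`-points of `Y` and `T` for their preimage in `C(K)`. The points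
over `𝔽_{qⁿ}` are the `K`-points fixed by the `n`-th iterate of Frobenius, and normalization is
bijective on `K`-points away from `T` and `S`. So the point counts of `Y` and `C` differ only
through the fixed points on the finite sets `S` and `T`, which Frobenius permutes.

For a permutation of a finite set, the exponential of the fixed-point series is the Euler product of
`1 / (1 - X ^ d)` over the orbits, `d` being the length. Hence `Z_Y / Z_C` is the product of `1 - X
^ e` over the orbits in `T`, divided by the product of `1 - X ^ d` over the orbits in `S`. Each
orbit of length `d` in `S` lies below some orbit in `T`, whose length is a multiple of `d`. The
quotient is therefore a polynomial, orbit by orbit, of degree `#T - #S`.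

Consider the factor of one orbit of length `d` in `S`. If two orbits lie above it, the factor
vanishes at `1`. If one orbit of length `e ≠ d` lies above it, the factor vanishes at a primitive
`e`-th root of unity, which can be `-1` only for `e = 2`, `d = 1`. The surviving cases are the
factors `1` and `1 + X`, that is, conditions (a) and (b). This is
`Equiv.Perm.exists_quotient_orbitPolynomial`.

The geometric input is local on `Y`. Lying over gives surjectivity (`CurveZeta.push_surjective`). In
dimension at most one regular local domains are normal, which gives one-point fibres off `S`
(`CurveZeta.fibre_subsingleton_of_regular`). Generic normality over a perfect field makes `S` finite
(`CurveZeta.finite_singularPoints`). A Krull-Akizuki argument makes the fibres over `S` finite using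
only that `u` is integral and birational (`CurveZeta.finite_fibre_of_singular`). -/

namespace PowerSeries

/-! ### Exponentials of power series -/

theorem constantCoeff_exp_subst {g : PowerSeries ℚ} (hg : constantCoeff g = 0) :
    constantCoeff ((exp ℚ).subst g) = 1 := by
  have h : exp ℚ = 1 + (exp ℚ - 1) := by ring
  have hs : HasSubst g := HasSubst.of_constantCoeff_zero' hg
  have h0 : constantCoeff ((exp ℚ - 1).subst g) = 0 :=
    constantCoeff_subst_eq_zero hg _ (by simp)
  rw [h, subst_add hs, map_add, h0, ← coe_substAlgHom hs, map_one, map_one, add_zero]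

theorem derivative_exp_subst {g : PowerSeries ℚ} (hg : constantCoeff g = 0) :
    derivative ℚ ((exp ℚ).subst g) = (exp ℚ).subst g * derivative ℚ g := by
  rw [derivative_subst (HasSubst.of_constantCoeff_zero' hg), derivative_exp]

/-- The exponential identities below are checked by this criterion: move everything to one side,
then show that the product has zero derivative and constant term `1`. -/
theorem eq_one_of_derivative_eq_zero {f : PowerSeries ℚ} (h : derivative ℚ f = 0)
    (hc : constantCoeff f = 1) : f = 1 :=
  derivative.ext (by rw [h, Derivation.map_one_eq_zero]) (by simp [hc])

theorem exp_subst_mul_exp_subst_neg {g : PowerSeries ℚ} (hg : constantCoeff g = 0) :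
    (exp ℚ).subst g * (exp ℚ).subst (-g) = 1 := by
  have hn : constantCoeff (-g) = 0 := by simp [hg]
  apply eq_one_of_derivative_eq_zero
  · rw [Derivation.leibniz, derivative_exp_subst hg, derivative_exp_subst hn, map_neg]
    simp only [smul_eq_mul]
    ring
  · rw [map_mul, constantCoeff_exp_subst hg, constantCoeff_exp_subst hn, mul_one]

theorem exp_subst_add {g h : PowerSeries ℚ} (hg : constantCoeff g = 0)
    (hh : constantCoeff h = 0) :
    (exp ℚ).subst (g + h) = (exp ℚ).subst g * (exp ℚ).subst h := by
  have hgh : constantCoeff (g + h) = 0 := by simp [hg, hh]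
  have hn : constantCoeff (-(g + h)) = 0 := by simp [hg, hh]
  have key : (exp ℚ).subst g * (exp ℚ).subst h * (exp ℚ).subst (-(g + h)) = 1 := by
    apply eq_one_of_derivative_eq_zero
    · simp only [Derivation.leibniz, derivative_exp_subst hg, derivative_exp_subst hh,
        derivative_exp_subst hn, map_neg, map_add, smul_eq_mul]
      ring
    · rw [map_mul, map_mul, constantCoeff_exp_subst hg, constantCoeff_exp_subst hh,
        constantCoeff_exp_subst hn, mul_one, mul_one]
  calc (exp ℚ).subst (g + h)
      = (exp ℚ).subst (g + h) *
        ((exp ℚ).subst g * (exp ℚ).subst h * (exp ℚ).subst (-(g + h))) := by rw [key, mul_one]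
    _ = (exp ℚ).subst g * (exp ℚ).subst h *
        ((exp ℚ).subst (g + h) * (exp ℚ).subst (-(g + h))) := by ring
    _ = _ := by rw [exp_subst_mul_exp_subst_neg hgh, mul_one]

theorem exp_subst_sum {ι : Type*} (I : Finset ι) (g : ι → PowerSeries ℚ)
    (hg : ∀ i, constantCoeff (g i) = 0) :
    (exp ℚ).subst (∑ i ∈ I, g i) = ∏ i ∈ I, (exp ℚ).subst (g i) := by
  classical
  induction I using Finset.induction_on with
  | empty =>
    rw [Finset.sum_empty, Finset.prod_empty]
    -- The series `exp 0` equals its own square, and that square is `1`.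
    have h := exp_subst_mul_exp_subst_neg (g := 0) (by simp)
    have h2 := exp_subst_add (g := 0) (h := 0) (by simp) (by simp)
    rw [add_zero] at h2
    rw [neg_zero, ← h2] at h
    exact h
  | insert a I ha ih =>
    rw [Finset.sum_insert ha, Finset.prod_insert ha, exp_subst_add (hg a) (by simp [hg]), ih]

/-- The series `-log (1 - X ^ d) = ∑_{d ∣ n} d Xⁿ / n`. -/
noncomputable def negLogOneSubPow (d : ℕ) : PowerSeries ℚ :=
  mk fun n => (if d ∣ n then (d : ℚ) else 0) / (n : ℚ)

theorem constantCoeff_negLogOneSubPow (d : ℕ) : constantCoeff (negLogOneSubPow d) = 0 := by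
  simp [negLogOneSubPow, ← coeff_zero_eq_constantCoeff_apply]

theorem derivative_negLogOneSubPow {d : ℕ} (hd : 0 < d) :
    derivative ℚ (negLogOneSubPow d) * (1 - X ^ d) = (d : PowerSeries ℚ) * X ^ (d - 1) := by
  have h : derivative ℚ (negLogOneSubPow d) = mk fun n => if d ∣ n + 1 then (d : ℚ) else 0 := by
    ext n
    rw [coeff_derivative, negLogOneSubPow, coeff_mk, coeff_mk]
    have : ((n : ℚ) + 1) ≠ 0 := by positivity
    push_cast
    field_simp
  rw [h]
  ext n
  rw [mul_sub, mul_one, map_sub, coeff_mul_X_pow', coeff_mk]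
  have hC : (d : PowerSeries ℚ) = C (d : ℚ) := by simp
  rw [hC, coeff_C_mul, coeff_X_pow]
  by_cases hdn : d ≤ n
  · have h1 : n - d + 1 = n + 1 - d := by omega
    have h2 : d ∣ n + 1 - d ↔ d ∣ n + 1 := by
      rw [Nat.dvd_sub_iff_left (by omega) dvd_rfl]
    rw [if_pos hdn, coeff_mk, h1, if_neg (show n ≠ d - 1 by omega)]
    simp [h2]
  · rw [if_neg hdn, sub_zero]
    by_cases hn : n = d - 1
    · rw [if_pos hn, if_pos (by subst hn; rw [Nat.sub_add_cancel hd]), mul_one]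
    · rw [if_neg hn, if_neg, mul_zero]
      intro hdvd
      have := Nat.le_of_dvd (by omega) hdvd
      omega

theorem exp_subst_negLogOneSubPow {d : ℕ} (hd : 0 < d) :
    (exp ℚ).subst (negLogOneSubPow d) * (1 - X ^ d) = 1 := by
  have h0 := constantCoeff_negLogOneSubPow d
  apply eq_one_of_derivative_eq_zero
  · have hX : derivative ℚ (1 - X ^ d : PowerSeries ℚ) = - ((d : PowerSeries ℚ) * X ^ (d - 1)) := by
      rw [map_sub, Derivation.map_one_eq_zero, Derivation.leibniz_pow, derivative_X]
      simp [nsmul_eq_mul]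
    rw [Derivation.leibniz, derivative_exp_subst h0, hX, smul_eq_mul, smul_eq_mul,
      ← derivative_negLogOneSubPow hd]
    ring
  · rw [map_mul, constantCoeff_exp_subst h0]
    simp [hd.ne']

end PowerSeries

/-! ### Orbits of a permutation and their Euler product -/

namespace Equiv.Perm

open MulAction Polynomial

variable {S T : Type*} (σ : Perm S) (τ : Perm T)

/-- The set of orbits of a permutation. -/
abbrev Orbits : Type _ := Quotient (SameCycle.setoid σ)

variable {σ τ}

theorem zpow_apply_eq_iff_period_dvd {s : S} {j : ℤ} :
    (σ ^ j) s = s ↔ (period σ s : ℤ) ∣ j :=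
  zpow_smul_eq_iff_period_dvd (g := σ) (a := s)

theorem pow_apply_eq_iff_period_dvd {s : S} {j : ℕ} :
    (σ ^ j) s = s ↔ period σ s ∣ j :=
  pow_smul_eq_iff_period_dvd (m := σ) (a := s)

theorem SameCycle.period_eq {s s' : S} (h : SameCycle σ s s') : period σ s = period σ s' := by
  obtain ⟨i, rfl⟩ := h
  have key : ∀ j : ℕ, period σ s ∣ j ↔ period σ ((σ ^ i) s) ∣ j := fun j => by
    rw [← pow_apply_eq_iff_period_dvd, ← pow_apply_eq_iff_period_dvd, ← mul_apply,
      ((Commute.refl σ).pow_left j |>.zpow_right i).eq, mul_apply, (σ ^ i).injective.eq_iff]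
  exact Nat.dvd_antisymm ((key _).2 dvd_rfl) ((key _).1 dvd_rfl)

/-- The number of elements of an orbit. -/
noncomputable def orbitLength : Orbits σ → ℕ :=
  Quotient.lift (period σ) fun _ _ h => SameCycle.period_eq h

theorem orbitLength_mk (s : S) : orbitLength (σ := σ) ⟦s⟧ = period σ s := rfl

theorem orbitLength_pos [Finite S] (o : Orbits σ) : 0 < orbitLength o := by
  induction o using Quotient.inductionOn with
  | h s => exact period_pos_of_orderOf_pos (isOfFinOrder_of_finite σ).orderOf_pos s

theorem orbit_mk_eq_iff {s s' : S} : (⟦s⟧ : Orbits σ) = ⟦s'⟧ ↔ ∃ i : ℤ, (σ ^ i) s = s' :=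
  Quotient.eq (r := SameCycle.setoid σ)

open Classical in
theorem card_orbit_eq [Fintype S] (o : Orbits σ) :
    (Finset.univ.filter fun s : S => (⟦s⟧ : Orbits σ) = o).card = orbitLength o := by
  induction o using Quotient.inductionOn with
  | h s =>
    rw [orbitLength_mk, period_eq_minimalPeriod, minimalPeriod_eq_card, ← Fintype.card_subtype]
    refine Fintype.card_congr (Equiv.subtypeEquivRight fun s' => ?_)
    rw [eq_comm, orbit_mk_eq_iff, mem_orbit_iff]
    constructor
    · rintro ⟨i, hi⟩
      exact ⟨⟨σ ^ i, i, rfl⟩, hi⟩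
    · rintro ⟨⟨_, i, rfl⟩, hi⟩
      exact ⟨i, hi⟩

open Classical in
theorem sum_orbitLength [Fintype S] : ∑ o : Orbits σ, orbitLength o = Fintype.card S := by
  simp_rw [← card_orbit_eq]
  rw [← Finset.card_eq_sum_card_fiberwise (fun _ _ => Finset.mem_univ _), Finset.card_univ]

open Classical in
-- All points of an orbit have the same period, so each orbit is fixed by `σ ^ n` entirely or not at
-- all.
theorem card_fixed_pow [Fintype S] (n : ℕ) :
    Nat.card {s : S // (σ ^ n) s = s} =
      ∑ o : Orbits σ, if orbitLength o ∣ n then orbitLength o else 0 := by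
  rw [Nat.card_eq_fintype_card, Fintype.card_subtype, Finset.card_filter,
    ← Finset.sum_fiberwise _ (fun s : S => (⟦s⟧ : Orbits σ))]
  refine Finset.sum_congr rfl fun o _ => ?_
  rw [Finset.sum_congr rfl (g := fun _ => if orbitLength o ∣ n then 1 else 0), Finset.sum_const,
    card_orbit_eq]
  · simp
  · intro s hs
    rw [Finset.mem_filter] at hs
    simp only [← hs.2, orbitLength_mk, pow_apply_eq_iff_period_dvd]

open Classical in
/-- The polynomial `∏ (1 - X ^ d)`, where `d` runs over the lengths of the orbits. -/
noncomputable def orbitPolynomial [Fintype S] (σ : Perm S) : ℚ[X] :=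
  ∏ o : Orbits σ, (1 - X ^ orbitLength o)

open Classical in
theorem exp_subst_card_fixed_mul_orbitPolynomial [Fintype S] (σ : Perm S) :
    (PowerSeries.exp ℚ).subst
        (PowerSeries.mk fun n : ℕ => (Nat.card {s : S // (σ ^ n) s = s} : ℚ) / (n : ℚ)) *
      (orbitPolynomial σ : PowerSeries ℚ) = 1 := by
  have h : (PowerSeries.mk fun n : ℕ => (Nat.card {s : S // (σ ^ n) s = s} : ℚ) / (n : ℚ)) =
      ∑ o : Orbits σ, PowerSeries.negLogOneSubPow (orbitLength o) := by
    ext n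
    simp only [PowerSeries.coeff_mk, map_sum, PowerSeries.negLogOneSubPow, card_fixed_pow,
      Nat.cast_sum, Finset.sum_div]
    exact Finset.sum_congr rfl fun o _ => by split_ifs <;> simp
  have h2 : (orbitPolynomial σ : PowerSeries ℚ) =
      ∏ o : Orbits σ, (1 - PowerSeries.X ^ orbitLength o) := by
    rw [orbitPolynomial, ← coeToPowerSeries.ringHom_apply, map_prod]
    simp
  rw [h, h2, PowerSeries.exp_subst_sum _ _
    (fun o => PowerSeries.constantCoeff_negLogOneSubPow _), ← Finset.prod_mul_distrib]
  exact Finset.prod_eq_one fun o _ => PowerSeries.exp_subst_negLogOneSubPow (orbitLength_pos o)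

theorem one_sub_X_pow_ne_zero {d : ℕ} (hd : 0 < d) : (1 - X ^ d : ℚ[X]) ≠ 0 := by
  intro h
  have := congrArg (eval 0) h
  simp [hd.ne'] at this

theorem natDegree_one_sub_X_pow (d : ℕ) : (1 - X ^ d : ℚ[X]).natDegree = d := by
  rw [← neg_sub, natDegree_neg, ← C_1, natDegree_X_pow_sub_C]

theorem orbitPolynomial_ne_zero [Fintype S] (σ : Perm S) : orbitPolynomial σ ≠ 0 :=
  Finset.prod_ne_zero_iff.2 fun o _ => one_sub_X_pow_ne_zero (orbitLength_pos o)

theorem natDegree_orbitPolynomial [Fintype S] (σ : Perm S) :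
    (orbitPolynomial σ).natDegree = Fintype.card S := by
  classical
  rw [orbitPolynomial, natDegree_prod _ _ fun o _ => one_sub_X_pow_ne_zero (orbitLength_pos o),
    ← sum_orbitLength (σ := σ)]
  exact Finset.sum_congr rfl fun o _ => natDegree_one_sub_X_pow _

theorem one_sub_X_pow_dvd {d e : ℕ} (h : d ∣ e) : (1 - X ^ d : ℚ[X]) ∣ 1 - X ^ e := by
  obtain ⟨m, rfl⟩ := h
  rw [pow_mul]
  exact one_sub_dvd_one_sub_pow _ _

theorem eq_one_of_mul_eq_self {d : ℕ} (hd : 0 < d) {E : ℚ[X]}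
    (h : E * (1 - X ^ d) = 1 - X ^ d) : E = 1 :=
  mul_right_cancel₀ (one_sub_X_pow_ne_zero hd) (by rw [h, one_mul])

/-- The left product vanishes at `1` to order at least two, whereas `1 - X ^ d` has only a simple
zero there, so `E` vanishes at `1`. This excludes two orbits above one. -/
theorem aeval_one_eq_zero_of_dvd {d a b : ℕ} (hd : 0 < d) {E : ℚ[X]}
    (h : (1 - X ^ a) * (1 - X ^ b) ∣ E * (1 - X ^ d)) : aeval (1 : ℂ) E = 0 := by
  obtain ⟨R, hR⟩ := h
  have key : (∑ i ∈ Finset.range d, X ^ i) * E = (1 - X ^ a) *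
      ((∑ i ∈ Finset.range b, X ^ i) * R) := by
    apply mul_left_cancel₀ (a := (1 - X : ℚ[X]))
    · simpa using one_sub_X_pow_ne_zero one_pos
    · have hb := mul_neg_geom_sum (X : ℚ[X]) b
      have hdd := mul_neg_geom_sum (X : ℚ[X]) d
      calc _ = E * ((1 - X) * ∑ i ∈ Finset.range d, X ^ i) := by ring
        _ = (1 - X ^ a) * (((1 - X) * ∑ i ∈ Finset.range b, X ^ i)) * R := by rw [hdd, hb, hR]
        _ = _ := by ring
  have := congrArg (aeval (1 : ℂ)) key
  simpa [hd.ne'] using this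

/-- A primitive `e`-th root of unity is a root of `1 - X ^ e` but not of `1 - X ^ d`, as `0 < d <
e`. So it is a root of `E`, hence equal to `-1`, and `e ∣ 2`. -/
theorem eq_two_of_forall_root_eq_neg_one {d e : ℕ} (hd : 0 < d) (hde : d ∣ e) (he : 0 < e)
    (hne : e ≠ d) {E : ℚ[X]} (h : E * (1 - X ^ d) = 1 - X ^ e)
    (hE : ∀ z : ℂ, z ≠ 0 → aeval z E = 0 → z = -1) : d = 1 ∧ e = 2 := by
  have hlt : d < e := lt_of_le_of_ne (Nat.le_of_dvd he hde) hne.symm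
  obtain ⟨z, hz⟩ : ∃ z : ℂ, IsPrimitiveRoot z e := ⟨_, Complex.isPrimitiveRoot_exp e he.ne'⟩
  have h1 : aeval z E * (1 - z ^ d) = 0 := by
    have := congrArg (aeval z) h
    simpa [hz.pow_eq_one] using this
  have h2 : (1 - z ^ d) ≠ 0 := sub_ne_zero.2 (hz.pow_ne_one_of_pos_of_lt hd.ne' hlt).symm
  have h3 := hE z (hz.ne_zero he.ne') ((mul_eq_zero.1 h1).resolve_right h2)
  have h4 : e ∣ 2 := hz.dvd_of_pow_eq_one 2 (by rw [h3]; norm_num)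
  have h5 := Nat.le_of_dvd two_pos h4
  omega

/-- The fibre above `s` is a single point, or `s` is fixed and its fibre consists of two points
which are exchanged. -/
def IsBranch (p : T → S) (σ : Perm S) (τ : Perm T) (s : S) : Prop :=
  (∃ t, p ⁻¹' {s} = {t}) ∨
    (σ s = s ∧ ∃ t t', t ≠ t' ∧ p ⁻¹' {s} = {t, t'} ∧ τ t = t' ∧ τ t' = t)

/-! ### Equivariant maps and the quotient of orbit polynomials -/

section Semiconj

variable {p : T → S} (hp : ∀ t, p (τ t) = σ (p t))
include hp

theorem map_zpow_apply (i : ℤ) (t : T) : p ((τ ^ i) t) = (σ ^ i) (p t) := by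
  have hpow (n : ℕ) (t : T) : p ((τ ^ n) t) = (σ ^ n) (p t) := by
    induction n generalizing t with
    | zero => rfl
    | succ n ih => rw [pow_succ, pow_succ, mul_apply, mul_apply, ih, hp]
  cases i with
  | ofNat n => simpa using hpow n t
  | negSucc n =>
    rw [zpow_negSucc, zpow_negSucc, Perm.eq_inv_iff_eq, ← hpow, ← mul_apply, mul_inv_cancel,
      one_apply]

/-- The map between sets of orbits induced by an equivariant map. -/
def mapOrbits : Orbits τ → Orbits σ :=
  Quotient.map' p fun _ _ ⟨i, hi⟩ => ⟨i, by rw [← map_zpow_apply hp, hi]⟩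

theorem mapOrbits_mk (t : T) : mapOrbits hp ⟦t⟧ = ⟦p t⟧ := rfl

theorem orbitLength_mapOrbits_dvd (o : Orbits τ) :
    orbitLength (mapOrbits hp o) ∣ orbitLength o := by
  induction o using Quotient.inductionOn with
  | h t =>
    rw [mapOrbits_mk, orbitLength_mk, orbitLength_mk, ← Int.natCast_dvd_natCast,
      ← zpow_apply_eq_iff_period_dvd, ← map_zpow_apply hp, zpow_apply_eq_iff_period_dvd.2 dvd_rfl]

theorem exists_mem_fibre_of_mapOrbits_eq {s : S} {o : Orbits τ} (h : mapOrbits hp o = ⟦s⟧) :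
    ∃ t, p t = s ∧ ⟦t⟧ = o := by
  induction o using Quotient.inductionOn with
  | h t =>
    rw [mapOrbits_mk, orbit_mk_eq_iff] at h
    obtain ⟨i, hi⟩ := h
    refine ⟨(τ ^ i) t, by rw [map_zpow_apply hp, hi], ?_⟩
    rw [eq_comm, orbit_mk_eq_iff]
    exact ⟨i, rfl⟩

open Classical in
-- By surjectivity some orbit lies above `o`, and its length is a multiple of that of `o`. Its
-- factor alone is already divisible by `1 - X ^ orbitLength o`.
theorem exists_orbitPolynomial_factor [Fintype T] [Finite S] (hsurj : Function.Surjective p)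
    (o : Orbits σ) : ∃ E : ℚ[X], E * (1 - X ^ orbitLength o) =
      ∏ o' : Orbits τ with mapOrbits hp o' = o, (1 - X ^ orbitLength o') := by
  obtain ⟨s, rfl⟩ := Quotient.exists_rep o
  obtain ⟨t, rfl⟩ := hsurj s
  have h1 : (1 - X ^ orbitLength (mapOrbits hp ⟦t⟧) : ℚ[X]) ∣ _ :=
    (one_sub_X_pow_dvd (orbitLength_mapOrbits_dvd hp ⟦t⟧)).trans
      (Finset.dvd_prod_of_mem (fun o' : Orbits τ => (1 - X ^ orbitLength o' : ℚ[X]))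
        (Finset.mem_filter.2 ⟨Finset.mem_univ _, rfl⟩ :
          ⟦t⟧ ∈ Finset.univ.filter fun o' => mapOrbits hp o' = mapOrbits hp ⟦t⟧))
  obtain ⟨E, hE⟩ := h1
  exact ⟨E, by rw [mul_comm]; exact hE.symm⟩

theorem period_eq_of_fibre_eq_singleton {s : S} {t : T} (h : p ⁻¹' {s} = {t}) :
    period τ t = period σ s := by
  have ht : p t = s := h.ge rfl
  apply Nat.dvd_antisymm
  · rw [← Int.natCast_dvd_natCast, ← zpow_apply_eq_iff_period_dvd]
    have : (τ ^ (period σ s : ℤ)) t ∈ p ⁻¹' {s} := by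
      rw [Set.mem_preimage, map_zpow_apply hp, ht, zpow_apply_eq_iff_period_dvd.2 dvd_rfl]; rfl
    rwa [h] at this
  · have := orbitLength_mapOrbits_dvd hp (⟦t⟧ : Orbits τ)
    rwa [mapOrbits_mk, orbitLength_mk, orbitLength_mk, ht] at this

/-- When a single orbit lies above that of `s`, the fibre over `s` consists of the `τ ^ j t` with
`j` divisible by the period of `s`. The two lengths then determine the fibre. -/
theorem isBranch_iff_orbits {s : S} {t : T} (ht : p t = s) :
    IsBranch p σ τ s ↔ (∀ o, mapOrbits hp o = ⟦s⟧ → o = ⟦t⟧) ∧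
      (period τ t = period σ s ∨ (period σ s = 1 ∧ period τ t = 2)) := by
  constructor
  · rintro (⟨t₀, h⟩ | ⟨hs, t₁, t₂, hne, h, h12, h21⟩)
    · obtain rfl : t = t₀ := h.le ht
      refine ⟨fun o ho => ?_, .inl (period_eq_of_fibre_eq_singleton hp h)⟩
      obtain ⟨t', ht', rfl⟩ := exists_mem_fibre_of_mapOrbits_eq hp ho
      rw [show t' = t from h.le ht']
    · have hs1 : period σ s = 1 := by
        rw [← Nat.dvd_one, ← pow_apply_eq_iff_period_dvd, pow_one, hs]
      have hper : ∀ x, x = t₁ ∨ x = t₂ → τ x ≠ x ∧ τ (τ x) = x := by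
        rintro x (rfl | rfl)
        · rw [h12, h21]; exact ⟨hne.symm, rfl⟩
        · rw [h21, h12]; exact ⟨hne, rfl⟩
      have htt : t = t₁ ∨ t = t₂ := by simpa using h.le ht
      have hmem : ∀ x, x = t₁ ∨ x = t₂ → x = t ∨ x = τ t := by
        rintro x (rfl | rfl) <;> rcases htt with rfl | rfl <;> simp [h12, h21]
      refine ⟨fun o ho => ?_, .inr ⟨hs1, ?_⟩⟩
      · obtain ⟨t', ht', rfl⟩ := exists_mem_fibre_of_mapOrbits_eq hp ho
        rcases hmem t' (by simpa using h.le ht') with rfl | rfl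
        · rfl
        · rw [eq_comm, orbit_mk_eq_iff]
          exact ⟨1, by simp⟩
      · have h2 : period τ t ∣ 2 := by
          rw [← pow_apply_eq_iff_period_dvd, pow_two, mul_apply, (hper t htt).2]
        have h1 : ¬ period τ t ∣ 1 := by
          rw [← pow_apply_eq_iff_period_dvd, pow_one]
          exact (hper t htt).1
        have := Nat.le_of_dvd two_pos h2
        interval_cases h : period τ t <;> simp_all
  · rintro ⟨hu, hper⟩
    have hfib : ∀ t', p t' = s → ∃ j : ℤ, (τ ^ j) t = t' ∧ (period σ s : ℤ) ∣ j := by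
      intro t' ht'
      have h1 := hu ⟦t'⟧ (by rw [mapOrbits_mk, ht'])
      rw [eq_comm, orbit_mk_eq_iff] at h1
      obtain ⟨j, hj⟩ := h1
      refine ⟨j, hj, ?_⟩
      rw [← zpow_apply_eq_iff_period_dvd, ← ht, ← map_zpow_apply hp, hj, ht', ht]
    rcases hper with hper | ⟨h1, h2⟩
    · refine .inl ⟨t, ?_⟩
      ext t'
      refine ⟨fun h => ?_, ?_⟩
      · obtain ⟨j, rfl, hj⟩ := hfib t' h
        rw [← hper, ← zpow_apply_eq_iff_period_dvd] at hj
        exact hj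
      · rintro rfl
        exact ht
    · have hs : σ s = s := by
        simpa using pow_apply_eq_iff_period_dvd (σ := σ) (s := s) (j := 1) |>.2 (by rw [h1])
      have ht2 : τ (τ t) = t := by
        simpa [pow_two] using
          pow_apply_eq_iff_period_dvd (σ := τ) (s := t) (j := 2) |>.2 (by rw [h2])
      have ht1 : t ≠ τ t := by
        intro h
        have := pow_apply_eq_iff_period_dvd (σ := τ) (s := t) (j := 1) |>.1 (by rw [pow_one, ← h])
        rw [h2] at this
        omega
      refine .inr ⟨hs, t, τ t, ht1, ?_, rfl, ht2⟩
      ext t'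
      refine ⟨fun h => ?_, ?_⟩
      · obtain ⟨j, rfl, -⟩ := hfib t' h
        rcases Int.even_or_odd' j with ⟨m, rfl | rfl⟩
        · left
          rw [zpow_apply_eq_iff_period_dvd, h2]
          exact ⟨m, rfl⟩
        · right
          rw [Set.mem_singleton_iff, zpow_add, zpow_one, (Commute.refl τ).zpow_left (2 * m) |>.eq,
            mul_apply]
          congr 1
          rw [zpow_apply_eq_iff_period_dvd, h2]
          exact ⟨m, rfl⟩
      · rintro (rfl | rfl)
        · exact ht
        · rw [Set.mem_preimage, hp, ht, hs]; rfl

open Classical in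
theorem forall_root_eq_neg_one_iff [Fintype T] [Finite S] {s : S} (hs : ∃ t, p t = s) {E : ℚ[X]}
    (hE : E * (1 - X ^ orbitLength (⟦s⟧ : Orbits σ)) =
      ∏ o' : Orbits τ with mapOrbits hp o' = ⟦s⟧, (1 - X ^ orbitLength o')) :
    (∀ z : ℂ, z ≠ 0 → aeval z E = 0 → z = -1) ↔ IsBranch p σ τ s := by
  obtain ⟨t, ht⟩ := hs
  rw [isBranch_iff_orbits hp ht]
  have hmem : (⟦t⟧ : Orbits τ) ∈ Finset.univ.filter fun o' => mapOrbits hp o' = ⟦s⟧ := by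
    rw [Finset.mem_filter, mapOrbits_mk, ht]
    exact ⟨Finset.mem_univ _, rfl⟩
  have hd := orbitLength_pos (⟦s⟧ : Orbits σ)
  have hsingle (hu : ∀ o, mapOrbits hp o = ⟦s⟧ → o = ⟦t⟧) :
      E * (1 - X ^ period σ s) = 1 - X ^ period τ t := by
    rw [orbitLength_mk] at hE
    rw [hE, Finset.prod_eq_single_of_mem _ hmem, orbitLength_mk]
    intro o ho hne
    exact absurd (hu o (Finset.mem_filter.1 ho).2) hne
  constructor
  · intro hroot
    have hu : ∀ o, mapOrbits hp o = ⟦s⟧ → o = ⟦t⟧ := by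
      intro o ho
      by_contra hne
      have h0 : aeval (1 : ℂ) E = 0 := by
        apply aeval_one_eq_zero_of_dvd hd (a := orbitLength o) (b := orbitLength (⟦t⟧ : Orbits τ))
        rw [hE, ← Finset.prod_pair hne (f := fun o : Orbits τ => (1 - X ^ orbitLength o : ℚ[X]))]
        apply Finset.prod_dvd_prod_of_subset
        intro o' ho'
        rcases Finset.mem_insert.1 ho' with rfl | ho'
        · exact Finset.mem_filter.2 ⟨Finset.mem_univ _, ho⟩
        · rwa [Finset.mem_singleton.1 ho']
      have := hroot 1 one_ne_zero h0
      norm_num at this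
    refine ⟨hu, or_iff_not_imp_left.2 fun hne => ?_⟩
    refine eq_two_of_forall_root_eq_neg_one hd ?_ (orbitLength_pos (⟦t⟧ : Orbits τ)) hne
      (hsingle hu) hroot
    have := orbitLength_mapOrbits_dvd hp (⟦t⟧ : Orbits τ)
    rwa [mapOrbits_mk, ht] at this
  · rintro ⟨hu, hper⟩ z hz0 hz
    have h1 := hsingle hu
    rcases hper with hper | ⟨hs1, ht2⟩
    · rw [hper] at h1
      rw [eq_one_of_mul_eq_self hd h1, map_one] at hz
      exact absurd hz one_ne_zero
    · rw [hs1, ht2] at h1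
      have h2 : E = 1 + X := by
        apply mul_right_cancel₀ (one_sub_X_pow_ne_zero one_pos)
        rw [h1]
        ring
      rw [h2] at hz
      simp only [map_add, map_one, aeval_X] at hz
      linear_combination hz

theorem exists_quotient_orbitPolynomial [Fintype S] [Fintype T] (hsurj : Function.Surjective p) :
    ∃ L : ℚ[X], L * orbitPolynomial σ = orbitPolynomial τ ∧
      L.natDegree + Fintype.card S = Fintype.card T ∧
      ((∀ z : ℂ, z ≠ 0 → aeval z L = 0 → z = -1) ↔ ∀ s, IsBranch p σ τ s) := by
  classical
  choose E hE using exists_orbitPolynomial_factor hp hsurj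
  have hL : (∏ o, E o) * orbitPolynomial σ = orbitPolynomial τ := by
    rw [orbitPolynomial, ← Finset.prod_mul_distrib, Finset.prod_congr rfl fun o _ => hE o,
      Finset.prod_fiberwise, orbitPolynomial]
  refine ⟨∏ o, E o, hL, ?_, ?_⟩
  · have hne : (∏ o, E o) ≠ 0 := by
      rintro h
      rw [h, zero_mul] at hL
      exact orbitPolynomial_ne_zero τ hL.symm
    rw [← natDegree_orbitPolynomial τ, ← hL, natDegree_mul hne (orbitPolynomial_ne_zero σ),
      natDegree_orbitPolynomial]
  · have h1 : (∀ z : ℂ, z ≠ 0 → aeval z (∏ o, E o) = 0 → z = -1) ↔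
        ∀ o, ∀ z : ℂ, z ≠ 0 → aeval z (E o) = 0 → z = -1 := by
      simp only [map_prod, Finset.prod_eq_zero_iff, Finset.mem_univ, true_and]
      exact ⟨fun h o z hz hzo => h z hz ⟨o, hzo⟩, fun h z hz ⟨o, hzo⟩ => h o z hz hzo⟩
    rw [h1]
    constructor
    · exact fun h s => (forall_root_eq_neg_one_iff hp (hsurj s) (hE ⟦s⟧)).1 (h ⟦s⟧)
    · intro h o
      obtain ⟨s, rfl⟩ := Quotient.exists_rep o
      exact (forall_root_eq_neg_one_iff hp (hsurj s) (hE ⟦s⟧)).2 (h s)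

end Semiconj

end Equiv.Perm

/-! ### One-dimensional domains: finite quotients and regularity -/

section OneDimensional

theorem Ideal.finite_quotient_span_singleton (k : Type*) {A : Type*} [Field k] [Finite k]
    [CommRing A] [IsDomain A] [Algebra k A] [Algebra.FiniteType k A] [Ring.KrullDimLE 1 A]
    {a : A} (ha : a ≠ 0) : Finite (A ⧸ Ideal.span {a}) := by
  have : Ring.KrullDimLE 0 (A ⧸ Ideal.span {a}) := by
    have h1 := ringKrullDim_quotient_succ_le_of_nonZeroDivisor
      (mem_nonZeroDivisors_of_ne_zero ha)
    have h2 : ringKrullDim A ≤ 1 := by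
      exact_mod_cast (Ring.krullDimLE_iff (n := 1)).1 ‹_›
    refine Ring.krullDimLE_iff.2 ?_
    refine Order.le_of_lt_succ (ENat.WithBot.lt_add_one_iff.2 ?_ : _ < (0 : WithBot ℕ∞) + 1)
    rw [← ENat.WithBot.add_le_add_one_right_iff]
    exact (h1.trans h2).trans_eq (zero_add _).symm
  have : Module.Finite k (A ⧸ Ideal.span {a}) := (Module.finite_iff_krullDimLE_zero k _).2 this
  exact Module.finite_of_finite k

/-- Multiplication by `a` has the same index on a nonzero ideal as on the whole ring. -/
theorem Ideal.relIndex_mul_left {A : Type*} [CommRing A] [IsDomain A] {a : A} (ha : a ≠ 0)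
    (I : Ideal A) (hI : I.toAddSubgroup.index ≠ 0) :
    (I.toAddSubgroup.map (AddMonoidHom.mulLeft a)).relIndex I.toAddSubgroup =
      (Ideal.span {a}).toAddSubgroup.index := by
  have hinj : Function.Injective (AddMonoidHom.mulLeft a) := mul_right_injective₀ ha
  have hrange : (AddMonoidHom.mulLeft a).range = (Ideal.span {a}).toAddSubgroup := by
    ext x
    simp only [AddMonoidHom.mem_range, AddMonoidHom.coe_mulLeft, Submodule.mem_toAddSubgroup,
      Ideal.mem_span_singleton', mul_comm a]
  have hle : I.toAddSubgroup.map (AddMonoidHom.mulLeft a) ≤ I.toAddSubgroup := by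
    rintro _ ⟨x, hx, rfl⟩
    exact I.mul_mem_left a hx
  -- The index of `aI` in `A` is computed through `I` and through `aA`. The common factor `[A : I]`
  -- is finite and cancels.
  have h1 := AddSubgroup.relIndex_mul_index hle
  rw [AddSubgroup.index_map_of_injective _ hinj, hrange, mul_comm] at h1
  exact Nat.eq_of_mul_eq_mul_left (Nat.pos_of_ne_zero hI) h1

theorem exists_common_denominator {A B ι : Type*} [CommRing A] [IsDomain A] [CommRing B]
    [Algebra A B] (hb : ∀ b : B, ∃ s : A, s ≠ 0 ∧ ∃ a : A, s • b = algebraMap A B a)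
    (I : Finset ι) (b : ι → B) :
    ∃ s : A, s ≠ 0 ∧ ∀ i ∈ I, ∃ a : A, s • b i = algebraMap A B a := by
  classical
  choose s hs a ha using hb
  refine ⟨∏ i ∈ I, s (b i), Finset.prod_ne_zero_iff.2 fun i _ => hs _, fun i hi => ?_⟩
  refine ⟨(∏ j ∈ I.erase i, s (b j)) * a (b i), ?_⟩
  rw [← Finset.prod_erase_mul _ _ hi, mul_smul, ha, map_mul, Algebra.smul_def]

/-- A form of the Krull-Akizuki theorem. -/
theorem Ideal.finite_quotient_span_singleton_of_birational {A B : Type*} [CommRing A] [IsDomain A]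
    [CommRing B] [IsDomain B] [Algebra A B] [FaithfulSMul A B]
    (hfin : ∀ a : A, a ≠ 0 → Finite (A ⧸ Ideal.span {a}))
    (hb : ∀ b : B, ∃ s : A, s ≠ 0 ∧ ∃ a : A, s • b = algebraMap A B a)
    {a : A} (ha : a ≠ 0) : Finite (B ⧸ Ideal.span {algebraMap A B a}) := by
  by_contra hinf
  rw [not_finite_iff_infinite] at hinf
  have := hfin a ha
  set N := (Ideal.span {a}).toAddSubgroup.index with hN
  obtain ⟨e⟩ : Nonempty (Fin (N + 1) ↪ B ⧸ Ideal.span {algebraMap A B a}) :=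
    ⟨(Fin.valEmbedding).trans (Infinite.natEmbedding _)⟩
  choose b hbe using fun i => Ideal.Quotient.mk_surjective (e i)
  obtain ⟨c, hc, hx⟩ := exists_common_denominator hb Finset.univ b
  choose x hx using fun i => hx i (Finset.mem_univ i)
  have hinj : Function.Injective (algebraMap A B) := FaithfulSMul.algebraMap_injective A B
  have hcB : algebraMap A B c ≠ 0 := by
    rwa [Ne, map_eq_zero_iff _ hinj]
  have hN0 : N ≠ 0 := AddSubgroup.index_ne_zero_iff_finite.2 (hfin a ha)
  -- The `N + 1` chosen elements of `B`, pairwise distinct modulo `a`, are scaled by `c` into `A`.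
  -- Since `[I : aI] = N`, two of the scaled elements must agree modulo `aI`.
  let I : Ideal A := Ideal.span (Set.range x)
  have hI0 : I.toAddSubgroup.index ≠ 0 := by
    obtain ⟨i, hi⟩ : ∃ i, x i ≠ 0 := by
      by_contra! h
      have hb0 : ∀ i, b i = 0 := fun i => by
        have := hx i
        rw [h i, map_zero, Algebra.smul_def] at this
        exact (mul_eq_zero.1 this).resolve_left hcB
      have : (0 : Fin (N + 1)) = Fin.last N := e.injective (by rw [← hbe, ← hbe, hb0, hb0])
      exact hN0 (by simpa [Fin.ext_iff, eq_comm] using this)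
    have h1 : (Ideal.span {x i}).toAddSubgroup.index ≠ 0 :=
      AddSubgroup.index_ne_zero_iff_finite.2 (hfin _ hi)
    have h2 : (Ideal.span {x i}).toAddSubgroup ≤ I.toAddSubgroup :=
      Ideal.span_mono (Set.singleton_subset_iff.2 ⟨i, rfl⟩)
    intro h
    exact h1 (Nat.eq_zero_of_zero_dvd (h ▸ AddSubgroup.index_dvd_of_le h2))
  have hcard := Ideal.relIndex_mul_left ha I hI0
  rw [AddSubgroup.relIndex, ← hN, AddSubgroup.index_eq_card] at hcard
  let Q := I.toAddSubgroup ⧸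
    (I.toAddSubgroup.map (AddMonoidHom.mulLeft a)).addSubgroupOf I.toAddSubgroup
  have : Finite Q := Nat.finite_of_card_ne_zero (hcard ▸ hN0)
  have : Fintype Q := Fintype.ofFinite Q
  let f : Fin (N + 1) → Q := fun i =>
    QuotientAddGroup.mk ⟨x i, Ideal.subset_span (Set.mem_range_self i)⟩
  obtain ⟨i, j, hij, hf⟩ := Fintype.exists_ne_map_eq_of_card_lt f (by
    rw [← Nat.card_eq_fintype_card, hcard, Fintype.card_fin]; omega)
  rw [QuotientAddGroup.eq, AddSubgroup.mem_addSubgroupOf] at hf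
  obtain ⟨y, hy, hyx⟩ := hf
  -- Every element of `I` is `c` times an element of `B`. Cancelling `c` turns the congruence modulo
  -- `aI` into one modulo `aB`, against distinctness.
  have hyB : ∃ y' : B, algebraMap A B y = algebraMap A B c * y' := by
    refine Submodule.span_induction (p := fun y _ => ∃ y' : B, algebraMap A B y =
      algebraMap A B c * y') ?_ ⟨0, by simp⟩ ?_ ?_ hy
    · rintro _ ⟨l, rfl⟩
      exact ⟨b l, by rw [← hx, Algebra.smul_def]⟩
    · rintro _ _ _ _ ⟨u, hu⟩ ⟨v, hv⟩
      exact ⟨u + v, by rw [map_add, hu, hv, mul_add]⟩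
    · rintro r _ _ ⟨u, hu⟩
      exact ⟨algebraMap A B r * u, by rw [smul_eq_mul, map_mul, hu]; ring⟩
  obtain ⟨y', hy'⟩ := hyB
  apply hij
  apply e.injective
  rw [← hbe, ← hbe, Ideal.Quotient.eq, Ideal.mem_span_singleton]
  refine ⟨-y', ?_⟩
  apply mul_left_cancel₀ hcB
  have h3 := congrArg (algebraMap A B) hyx
  simp only [AddMonoidHom.coe_mulLeft, map_mul, AddSubgroup.coe_add, AddSubgroup.coe_neg, map_add,
    map_neg, ← hx, Algebra.smul_def, hy'] at h3
  linear_combination h3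

/-- Homomorphisms to a field that kill a fixed nonzero element of the smaller ring. -/
theorem finite_algHom_of_birational (k : Type*) {A B K : Type*} [Field k] [Finite k]
    [CommRing A] [IsDomain A] [Algebra k A] [Algebra.FiniteType k A] [Ring.KrullDimLE 1 A]
    [CommRing B] [IsDomain B] [Algebra A B] [FaithfulSMul A B] [Algebra k B] [Field K]
    [Algebra k K] (hb : ∀ b : B, ∃ s : A, s ≠ 0 ∧ ∃ a : A, s • b = algebraMap A B a)
    {a : A} (ha : a ≠ 0) : {ψ : B →ₐ[k] K | ψ (algebraMap A B a) = 0}.Finite := by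
  have := Ideal.finite_quotient_span_singleton_of_birational
    (fun a ha => Ideal.finite_quotient_span_singleton k (A := A) (a := a) ha) hb ha
  have : Module.Finite k (B ⧸ Ideal.span {algebraMap A B a}) := Module.Finite.of_finite
  have : Finite ((B ⧸ Ideal.span {algebraMap A B a}) →ₐ[k] K) := inferInstance
  refine (Set.finite_range fun χ : (B ⧸ Ideal.span {algebraMap A B a}) →ₐ[k] K =>
    χ.comp (Ideal.Quotient.mkₐ k _)).subset fun ψ hψ => ?_
  refine ⟨Ideal.Quotient.liftₐ _ ψ fun b hb => ?_, ?_⟩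
  · obtain ⟨c, rfl⟩ := Ideal.mem_span_singleton.1 hb
    rw [map_mul, hψ, zero_mul]
  · ext b
    rfl

/-- The cotangent space has dimension at most one, so the ring is a principal ideal domain and thus
normal. With the converse below, regular and normal agree for the local rings of a curve. -/
theorem isIntegrallyClosed_of_isRegularLocalRing (R : Type*) [CommRing R] [IsDomain R]
    [IsRegularLocalRing R] [Ring.KrullDimLE 1 R] : IsIntegrallyClosed R := by
  have h : Module.finrank (IsLocalRing.ResidueField R) (IsLocalRing.CotangentSpace R) ≤ 1 := by
    have h1 := (IsRegularLocalRing.iff_finrank_cotangentSpace R).1 inferInstance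
    have h2 := (Ring.krullDimLE_iff (n := 1) (R := R)).1 inferInstance
    rw [← h1] at h2
    exact_mod_cast h2
  have : IsPrincipalIdealRing R :=
    ((tfae_of_isNoetherianRing_of_isLocalRing_of_isDomain R).out 5 0 :
      _ ≤ 1 ↔ IsPrincipalIdealRing R).1 h
  infer_instance

theorem isRegularLocalRing_of_isIntegrallyClosed (R : Type*) [CommRing R] [IsDomain R]
    [IsLocalRing R] [IsNoetherianRing R] [Ring.KrullDimLE 1 R] [IsIntegrallyClosed R] :
    IsRegularLocalRing R := by
  have : IsPrincipalIdealRing R :=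
    ((tfae_of_isNoetherianRing_of_isLocalRing_of_isDomain R).out 3 0 :
      (IsIntegrallyClosed R ∧ ∀ P : Ideal R, P ≠ ⊥ → P.IsPrime →
        P = IsLocalRing.maximalIdeal R) ↔ IsPrincipalIdealRing R).1
    ⟨inferInstance, fun P hP hP' => IsLocalRing.eq_maximalIdeal (hP'.isMaximal_of_ne_bot hP)⟩
  infer_instance

end OneDimensional

/-! ### Birational integral extensions and homomorphisms to a field -/

section Birational

theorem IsFractionRing.of_birational {A B : Type*} [CommRing A] [IsDomain A] [CommRing B]
    [IsDomain B] [Algebra A B] [FaithfulSMul A B] (L : Type*) [Field L] [Algebra B L]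
    [IsFractionRing B L] [Algebra A L] [IsScalarTower A B L]
    (hb : ∀ b : B, ∃ s : A, s ≠ 0 ∧ ∃ a : A, s • b = algebraMap A B a) :
    IsFractionRing A L := by
  have hinj : Function.Injective (algebraMap A L) := by
    rw [IsScalarTower.algebraMap_eq A B L]
    exact (IsFractionRing.injective B L).comp (FaithfulSMul.algebraMap_injective A B)
  have : FaithfulSMul A L := (faithfulSMul_iff_algebraMap_injective A L).2 hinj
  have hfrac : ∀ b : B, ∃ a s : A, s ≠ 0 ∧
      algebraMap B L b = algebraMap A L a / algebraMap A L s := by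
    intro b
    obtain ⟨s, hs, a, h⟩ := hb b
    refine ⟨a, s, hs, ?_⟩
    rw [eq_div_iff (by rwa [Ne, map_eq_zero_iff _ hinj]), IsScalarTower.algebraMap_apply A B L a,
      ← h, Algebra.smul_def, map_mul, ← IsScalarTower.algebraMap_apply, mul_comm]
  refine IsFractionRing.of_field A L fun z => ?_
  obtain ⟨b, c, -, rfl⟩ := IsFractionRing.div_surjective (A := B) z
  obtain ⟨a, s, hs, h1⟩ := hfrac b
  obtain ⟨a', s', hs', h2⟩ := hfrac c
  refine ⟨a * s', s * a', ?_⟩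
  rw [h1, h2, map_mul, map_mul, div_div_div_eq]

theorem IsFractionRing.of_isLocalization_atPrime {A Ap L : Type*} [CommRing A] [IsDomain A]
    [CommRing Ap] [IsDomain Ap] [Algebra A Ap] (p : Ideal A) [p.IsPrime]
    [IsLocalization.AtPrime Ap p] [Field L] [Algebra Ap L] [IsFractionRing Ap L] [Algebra A L]
    [IsScalarTower A Ap L] : IsFractionRing A L := by
  have : FaithfulSMul A Ap := (faithfulSMul_iff_algebraMap_injective A Ap).2
    (IsLocalization.injective Ap p.primeCompl_le_nonZeroDivisors)
  refine IsFractionRing.of_birational (B := Ap) L fun b => ?_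
  obtain ⟨⟨a, s⟩, h⟩ := IsLocalization.surj p.primeCompl b
  refine ⟨s, fun h0 => s.2 (h0 ▸ p.zero_mem), a, ?_⟩
  rw [Algebra.smul_def, mul_comm, h]

/-- An integral element of the fraction field is a fraction with denominator outside `p`, if the
local ring at `p` is integrally closed. -/
theorem exists_denominator_of_isIntegrallyClosed {A B : Type*} [CommRing A]
    [IsDomain A] [CommRing B] [IsDomain B] [Algebra A B] [FaithfulSMul A B]
    (hb : ∀ b : B, ∃ s : A, s ≠ 0 ∧ ∃ a : A, s • b = algebraMap A B a)
    (p : Ideal A) [p.IsPrime] (Ap : Type*) [CommRing Ap] [IsDomain Ap] [Algebra A Ap]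
    [IsLocalization.AtPrime Ap p] [IsIntegrallyClosed Ap] {b : B} (hint : IsIntegral A b) :
    ∃ s ∉ p, ∃ a : A, s • b = algebraMap A B a := by
  have := IsFractionRing.of_birational (FractionRing B) hb
  have : IsFractionRing A (FractionRing Ap) := IsFractionRing.of_isLocalization_atPrime (Ap := Ap) p
  -- Both fields are fraction fields of `A`, so `b` can be regarded as an element integral over the
  -- normal ring `Ap`.
  let e : FractionRing B ≃ₐ[A] FractionRing Ap :=
    IsLocalization.algEquiv (nonZeroDivisors A) _ _
  have hx : IsIntegral A (e (algebraMap B (FractionRing B) b)) :=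
    (hint.map (IsScalarTower.toAlgHom A B (FractionRing B))).map e
  obtain ⟨y, hy⟩ := (isIntegrallyClosed_iff (FractionRing Ap)).1 ‹IsIntegrallyClosed Ap›
    (hx.tower_top (A := Ap))
  obtain ⟨⟨a, s⟩, h⟩ := IsLocalization.surj p.primeCompl y
  refine ⟨s, s.2, a, ?_⟩
  apply IsFractionRing.injective B (FractionRing B)
  apply e.injective
  have h' := congrArg (algebraMap Ap (FractionRing Ap)) h
  rw [map_mul, hy, ← IsScalarTower.algebraMap_apply, ← IsScalarTower.algebraMap_apply] at h'
  rw [Algebra.smul_def, map_mul, map_mul, ← IsScalarTower.algebraMap_apply,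
    ← IsScalarTower.algebraMap_apply, AlgEquiv.commutes, AlgEquiv.commutes, mul_comm, h']

/-- Each `b` is a fraction `a / s` with `s ∉ p`. The value at `s` is then nonzero, and the value at
`b` is determined by the restriction to `A`. -/
theorem RingHom.eq_of_comp_algebraMap_eq_of_isIntegrallyClosed {A B K : Type*} [CommRing A]
    [IsDomain A] [CommRing B] [IsDomain B] [Algebra A B] [FaithfulSMul A B]
    [Algebra.IsIntegral A B] [Field K]
    (hb : ∀ b : B, ∃ s : A, s ≠ 0 ∧ ∃ a : A, s • b = algebraMap A B a)
    (p : Ideal A) [p.IsPrime] (Ap : Type*) [CommRing Ap] [IsDomain Ap] [Algebra A Ap]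
    [IsLocalization.AtPrime Ap p] [IsIntegrallyClosed Ap] {ψ₁ ψ₂ : B →+* K}
    (h : ψ₁.comp (algebraMap A B) = ψ₂.comp (algebraMap A B))
    (hp : RingHom.ker (ψ₁.comp (algebraMap A B)) = p) : ψ₁ = ψ₂ := by
  ext b
  obtain ⟨s, hs, a, hsa⟩ := exists_denominator_of_isIntegrallyClosed hb p Ap
    (Algebra.IsIntegral.isIntegral (R := A) b)
  have h0 : ψ₁ (algebraMap A B s) ≠ 0 := by
    rw [← hp, RingHom.mem_ker] at hs
    exact hs
  have hc : ∀ x, ψ₁ (algebraMap A B x) = ψ₂ (algebraMap A B x) := fun x => congrArg (· x) h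
  apply mul_left_cancel₀ h0
  rw [Algebra.smul_def] at hsa
  rw [← map_mul, hsa, hc, hc, ← map_mul, hsa]

/-- Lying over provides a prime `Q` above the kernel `P`. The integral extension `B ⧸ Q` of `A ⧸ P`
then maps to the algebraically closed field `K`. -/
theorem RingHom.exists_comp_algebraMap_eq_of_isIntegral {A B K : Type*} [CommRing A] [CommRing B]
    [Algebra A B] [FaithfulSMul A B] [Algebra.IsIntegral A B] [Field K] [IsAlgClosed K]
    (φ : A →+* K) : ∃ ψ : B →+* K, ψ.comp (algebraMap A B) = φ := by
  let P := RingHom.ker φ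
  have : P.IsPrime := RingHom.ker_isPrime φ
  obtain ⟨Q, -, hQ, hQP⟩ := Ideal.exists_ideal_over_prime_of_isIntegral P (⊥ : Ideal B) (by
    intro x hx
    have : x = 0 := FaithfulSMul.algebraMap_injective A B (by simpa using hx)
    rw [this]
    exact P.zero_mem)
  have : Q.LiesOver P := ⟨hQP.symm⟩
  let φ' : A ⧸ P →+* K := Ideal.Quotient.lift P φ fun a ha => ha
  let := φ'.toAlgebra
  have hinj : Function.Injective φ' := RingHom.kerLift_injective φ
  have : FaithfulSMul (A ⧸ P) K := (faithfulSMul_iff_algebraMap_injective _ _).2 hinj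
  have : FaithfulSMul (A ⧸ P) (B ⧸ Q) := inferInstance
  have : Module.IsTorsionFree (A ⧸ P) K := inferInstance
  have : Module.IsTorsionFree (A ⧸ P) (B ⧸ Q) := FaithfulSMul.to_isTorsionFree _ _
  have : Algebra.IsIntegral (A ⧸ P) (B ⧸ Q) := inferInstance
  let χ : B ⧸ Q →ₐ[A ⧸ P] K := IsAlgClosed.lift
  refine ⟨χ.toRingHom.comp (Ideal.Quotient.mk Q), ?_⟩
  ext a
  exact χ.commutes (Ideal.Quotient.mk P a)

end Birational

/-! ### Generic normality over a perfect field -/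

section GenericNormality

variable {k F : Type*} [Field k] [Field F] [Algebra k F]

theorem exists_pow_smul_mem_of_finiteType {R A' : Type*} [CommRing R] [IsDomain R] [Algebra k R]
    [Algebra R F] [IsScalarTower k R F] [IsFractionRing R F] [CommRing A'] [Algebra k A']
    [Algebra A' F] [IsScalarTower k A' F] [Algebra.FiniteType k A'] :
    ∃ r : R, r ≠ 0 ∧ ∀ x : A', ∃ (n : ℕ) (y : R),
      algebraMap R F r ^ n * algebraMap A' F x = algebraMap R F y := by
  obtain ⟨S, hS⟩ := Algebra.FiniteType.out (R := k) (A := A')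
  classical
  obtain ⟨r, hr⟩ := IsLocalization.exist_integer_multiples_of_finset (nonZeroDivisors R)
    (S.image (algebraMap A' F))
  refine ⟨r, nonZeroDivisors.ne_zero r.2, fun x => ?_⟩
  have hx : x ∈ Algebra.adjoin k (S : Set A') := hS ▸ Algebra.mem_top
  induction hx using Algebra.adjoin_induction with
  | mem x hx =>
    obtain ⟨y, hy⟩ := hr _ (Finset.mem_image_of_mem _ hx)
    exact ⟨1, y, by rw [hy, pow_one, Algebra.smul_def]⟩
  | algebraMap c =>
    refine ⟨0, algebraMap k R c, ?_⟩
    rw [pow_zero, one_mul, ← IsScalarTower.algebraMap_apply, ← IsScalarTower.algebraMap_apply]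
  | add u v _ _ hu hv =>
    obtain ⟨n, y, hy⟩ := hu
    obtain ⟨m, z, hz⟩ := hv
    refine ⟨n + m, r ^ m * y + r ^ n * z, ?_⟩
    rw [map_add, map_add, map_mul, map_mul, ← hy, ← hz, map_pow, map_pow]
    ring
  | mul u v _ _ hu hv =>
    obtain ⟨n, y, hy⟩ := hu
    obtain ⟨m, z, hz⟩ := hv
    refine ⟨n + m, y * z, ?_⟩
    rw [map_mul, map_mul, ← hy, ← hz]
    ring

/-- A field which is finitely generated over a perfect field is the fraction field of an
integrally closed algebra of finite type. -/
theorem exists_isIntegrallyClosed_finiteType_subalgebra [PerfectField k]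
    [Algebra.EssFiniteType k F] :
    ∃ D : Subalgebra k F, IsIntegrallyClosed D ∧ Algebra.FiniteType k D ∧ IsFractionRing D F := by
  -- With a separating transcendence basis, `F` is finite separable over the fraction field of the
  -- polynomial ring `P`. The integral closure of `P` in `F` is therefore finite over `P`, and
  -- serves as `D`.
  obtain ⟨s, hs, hsep⟩ := exists_isTranscendenceBasis_and_isSeparable_of_perfectField k F
  let P := Algebra.adjoin k (s : Set F)
  let E := IntermediateField.adjoin k (s : Set F)
  open scoped IntermediateField.algebraAdjoinAdjoin in
  have hPE : IsFractionRing P E := inferInstance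
  open scoped IntermediateField.algebraAdjoinAdjoin in
  have htower : IsScalarTower P E F := inferInstance
  let e : MvPolynomial s k ≃ₐ[k] P := hs.1.aevalEquiv.trans
    (Subalgebra.equivOfEq _ _ (by simp [P]))
  have : IsIntegrallyClosed P := .of_equiv e.toRingEquiv
  have : Algebra.FiniteType k P := Algebra.FiniteType.equiv inferInstance e
  have : IsNoetherianRing P := Algebra.FiniteType.isNoetherianRing k P
  have : Algebra.EssFiniteType E F := Algebra.EssFiniteType.of_comp k E F
  have : FiniteDimensional E F := Algebra.finite_of_essFiniteType_of_isAlgebraic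
  open scoped IntermediateField.algebraAdjoinAdjoin in
  have : Module.Finite P (integralClosure P F) := IsIntegralClosure.finite P E F _
  open scoped IntermediateField.algebraAdjoinAdjoin in
  have hfrac : IsFractionRing (integralClosure P F) F :=
    IsIntegralClosure.isFractionRing_of_finite_extension P E F _
  open scoped IntermediateField.algebraAdjoinAdjoin in
  have : IsIntegrallyClosed (integralClosure P F) :=
    integralClosure.isIntegrallyClosedOfFiniteExtension E
  have : Algebra.FiniteType P (integralClosure P F) := inferInstance
  exact ⟨(integralClosure P F).restrictScalars k, ‹IsIntegrallyClosed (integralClosure P F)›,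
    (Algebra.FiniteType.trans (S := P) ‹_› ‹_› : Algebra.FiniteType k (integralClosure P F)), hfrac⟩

/-- Scaling the root by `δ ^ N` multiplies the coefficient of index `i` by `δ ^ (N * (deg - i))`.
For large `N` this clears every denominator below the leading term. -/
theorem exists_pow_mul_isIntegral {A D : Type*} [CommRing A] [Algebra A F] [CommRing D]
    [Algebra D F] {δ : D} (hδ : ∀ a : A, ∃ (n : ℕ) (y : D),
      algebraMap D F δ ^ n * algebraMap A F a = algebraMap D F y) {x : F} (hx : IsIntegral A x) :
    ∃ n : ℕ, IsIntegral D (algebraMap D F δ ^ n * x) := by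
  obtain ⟨P, hP, hPx⟩ := hx
  choose n y hy using hδ
  let N := ∑ i ∈ Finset.range P.natDegree, n (P.coeff i)
  have hN : ∀ i < P.natDegree, n (P.coeff i) ≤ N := fun i hi =>
    Finset.single_le_sum (f := fun i => n (P.coeff i)) (fun _ _ => Nat.zero_le _)
      (Finset.mem_range.2 hi)
  refine ⟨N, ?_⟩
  let P' : Polynomial F := (P.map (algebraMap A F)).scaleRoots (algebraMap D F δ ^ N)
  have hmon : P'.Monic := (Polynomial.monic_scaleRoots_iff _).2 (hP.map _)
  have hdeg : (P.map (algebraMap A F)).natDegree = P.natDegree := hP.natDegree_map _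
  have hlift : P' ∈ Polynomial.lifts (algebraMap D F) := by
    rw [Polynomial.lifts_iff_coeff_lifts]
    intro i
    rw [Polynomial.coeff_scaleRoots, hdeg, Polynomial.coeff_map]
    rcases lt_trichotomy i P.natDegree with hi | hi | hi
    · obtain ⟨m, hm⟩ := Nat.exists_eq_add_of_le (hN i hi)
      obtain ⟨l, hl⟩ := Nat.exists_eq_succ_of_ne_zero (Nat.sub_ne_zero_of_lt hi)
      refine ⟨y (P.coeff i) * δ ^ (m + N * l), ?_⟩
      rw [map_mul, ← hy, map_pow, hl, ← pow_mul, Nat.mul_succ, hm]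
      ring
    · refine ⟨1, ?_⟩
      rw [hi, Nat.sub_self, pow_zero, hP.coeff_natDegree, map_one, map_one, mul_one]
    · refine ⟨0, ?_⟩
      rw [Polynomial.coeff_eq_zero_of_natDegree_lt hi, map_zero, map_zero, zero_mul]
  obtain ⟨Q, hQ, -, hQm⟩ := Polynomial.lifts_and_natDegree_eq_and_monic hlift hmon
  refine ⟨Q, hQm, ?_⟩
  rw [← Polynomial.eval_map, hQ, ← Polynomial.coe_aeval_eq_eval]
  refine Polynomial.scaleRoots_aeval_eq_zero ?_
  rw [Polynomial.coe_aeval_eq_eval, Polynomial.eval_map]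
  exact hPx

/-- `A` is compared with a normal finite type `D` having the same fraction field. A power of `δ`
moves `x` into `D`, by normality, and a power of `g` moves the result into `A`. As `δ = α / β` need
not lie in `A`, its numerator `α` replaces it. -/
theorem exists_pow_mul_mem_of_isIntegral [PerfectField k] {A : Type*} [CommRing A] [IsDomain A]
    [Algebra k A] [Algebra.FiniteType k A] [Algebra A F] [IsScalarTower k A F]
    [IsFractionRing A F] [Algebra.EssFiniteType k F] :
    ∃ h : A, h ≠ 0 ∧ ∀ x : F, IsIntegral A x → ∃ (n : ℕ) (a : A),
      algebraMap A F h ^ n * x = algebraMap A F a := by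
  obtain ⟨D, hD, hDf, hDF⟩ := exists_isIntegrallyClosed_finiteType_subalgebra (k := k) (F := F)
  obtain ⟨g, hg, hgD⟩ := exists_pow_smul_mem_of_finiteType (k := k) (F := F) (R := A) (A' := D)
  obtain ⟨δ, hδ, hδA⟩ := exists_pow_smul_mem_of_finiteType (k := k) (F := F) (R := D) (A' := A)
  obtain ⟨α, β, hβ, hαβ⟩ := IsFractionRing.div_surjective (A := A) (algebraMap D F δ)
  have hβ0 : algebraMap A F β ≠ 0 := IsFractionRing.to_map_ne_zero_of_mem_nonZeroDivisors hβ
  have hα : α ≠ 0 := by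
    rintro rfl
    rw [map_zero, zero_div, eq_comm, map_eq_zero_iff _ (IsFractionRing.injective D F)] at hαβ
    exact hδ hαβ
  refine ⟨g * α, mul_ne_zero hg hα, fun x hx => ?_⟩
  obtain ⟨n, hn⟩ := exists_pow_mul_isIntegral hδA hx
  obtain ⟨d, hd⟩ := (isIntegrallyClosed_iff F).1 hD hn
  obtain ⟨m, a, ha⟩ := hgD d
  refine ⟨m + n, g ^ n * α ^ m * β ^ n * a, ?_⟩
  rw [hd, ← hαβ, div_pow] at ha
  simp only [map_mul, map_pow, ← ha]
  field_simp
  ring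

/-- An element integral over `Ap` becomes integral over `A` after multiplication by some `s ∉ p`,
and then lies in `A` after multiplication by a power of `h`. Both are units of `Ap`. -/
theorem exists_forall_isIntegrallyClosed_localization (k : Type*) [Field k] [PerfectField k]
    (A : Type*) [CommRing A] [IsDomain A] [Algebra k A] [Algebra.FiniteType k A] :
    ∃ h : A, h ≠ 0 ∧ ∀ (p : Ideal A) [p.IsPrime], h ∉ p → ∀ (Ap : Type _) [CommRing Ap]
      [IsDomain Ap] [Algebra A Ap] [IsLocalization.AtPrime Ap p], IsIntegrallyClosed Ap := by
  have : Algebra.EssFiniteType A (FractionRing A) :=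
    Algebra.EssFiniteType.of_isLocalization _ (nonZeroDivisors A)
  have : Algebra.EssFiniteType k (FractionRing A) := Algebra.EssFiniteType.comp k A _
  obtain ⟨h, h0, hint⟩ := exists_pow_mul_mem_of_isIntegral (k := k) (A := A) (F := FractionRing A)
  refine ⟨h, h0, fun p _ hp Ap _ _ _ _ => ?_⟩
  have : IsFractionRing A (FractionRing Ap) := IsFractionRing.of_isLocalization_atPrime (Ap := Ap) p
  let e := FractionRing.algEquiv A (FractionRing Ap)
  rw [isIntegrallyClosed_iff (FractionRing Ap)]
  intro x hx
  obtain ⟨s, hs⟩ := hx.exists_multiple_integral_of_isLocalization p.primeCompl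
  obtain ⟨n, a, ha⟩ := hint (e.symm (s • x)) (hs.map e.symm)
  have ha' := congrArg e ha
  rw [map_mul, map_pow, AlgEquiv.apply_symm_apply, AlgEquiv.commutes, AlgEquiv.commutes,
    Submonoid.smul_def, Algebra.smul_def, ← mul_assoc, ← map_pow, ← map_mul] at ha'
  let t : p.primeCompl := ⟨h ^ n * s, p.primeCompl.mul_mem (p.primeCompl.pow_mem hp n) s.2⟩
  refine ⟨IsLocalization.mk' Ap a t, ?_⟩
  have ht : algebraMap A (FractionRing Ap) t ≠ 0 := by
    rw [Ne, map_eq_zero_iff _ (IsFractionRing.injective A _)]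
    exact fun h0 => t.2 (h0 ▸ p.zero_mem)
  apply mul_left_cancel₀ ht
  rw [IsScalarTower.algebraMap_apply A Ap, ← map_mul, IsLocalization.mk'_spec',
    ← IsScalarTower.algebraMap_apply, ← IsScalarTower.algebraMap_apply, ← ha']

end GenericNormality

/-! ### Field-valued points and Frobenius -/

namespace CurveZeta

section Maps

variable {k : Type u} [Field k] {X C Y : Scheme.{u}} {s : X ⟶ Spec (CommRingCat.of k)}

theorem Points.ext {A : Type u} [CommRing A] [Algebra k A] {x y : Points s A} (h : x.1 = y.1) :
    x = y :=
  Subtype.ext h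

theorem Points.map_comp {A B D : Type u} [CommRing A] [Algebra k A] [CommRing B] [Algebra k B]
    [CommRing D] [Algebra k D] (f : A →ₐ[k] B) (g : B →ₐ[k] D) (x : Points s A) :
    x.map (g.comp f) = (x.map f).map g := by
  apply Points.ext
  change Spec.map (CommRingCat.ofHom (g.toRingHom.comp f.toRingHom)) ≫ x.1 = _ ≫ _ ≫ x.1
  rw [CommRingCat.ofHom_comp, Spec.map_comp, Category.assoc]

theorem Points.map_id {A : Type u} [CommRing A] [Algebra k A] (x : Points s A) :
    x.map (AlgHom.id k A) = x := by
  apply Points.ext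
  change Spec.map (CommRingCat.ofHom (RingHom.id A)) ≫ x.1 = x.1
  rw [CommRingCat.ofHom_id, Spec.map_id, Category.id_comp]

/-- A field-valued point is a homomorphism from a residue field. -/
theorem Points.exists_eq_fromSpecResidueField {K : Type u} [Field K] [Algebra k K]
    (x : Points s K) : ∃ (p : X) (φ : X.residueField p ⟶ CommRingCat.of K),
      x.1 = Spec.map φ ≫ X.fromSpecResidueField p :=
  ⟨_, _, ((Scheme.SpecToEquivOfField K X).symm_apply_apply x.1).symm⟩

theorem Points.map_injective {L K : Type u} [Field L] [Algebra k L] [Field K] [Algebra k K]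
    (f : L →ₐ[k] K) : Function.Injective (Points.map f : Points s L → Points s K) := by
  intro x y h
  have h1 := congrArg Subtype.val h
  obtain ⟨p, φ, hφ⟩ := x.exists_eq_fromSpecResidueField
  obtain ⟨q, ψ, hψ⟩ := y.exists_eq_fromSpecResidueField
  change Spec.map (CommRingCat.ofHom f.toRingHom) ≫ x.1 =
    Spec.map (CommRingCat.ofHom f.toRingHom) ≫ y.1 at h1
  rw [hφ, hψ, ← Category.assoc, ← Category.assoc, ← Spec.map_comp, ← Spec.map_comp] at h1
  have h2 := (Scheme.SpecToEquivOfField K X).symm.injective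
    (a₁ := ⟨p, φ ≫ CommRingCat.ofHom f.toRingHom⟩) (a₂ := ⟨q, ψ ≫ CommRingCat.ofHom f.toRingHom⟩) h1
  obtain ⟨rfl, h3⟩ := Sigma.mk.inj_iff.1 h2
  have h4 := eq_of_heq h3
  have h5 : φ = ψ := by
    ext z
    exact f.toRingHom.injective (congrArg (fun g => g.hom z) h4)
  apply Points.ext
  rw [hφ, hψ, h5]

theorem Points.push_map {s : Y ⟶ Spec (CommRingCat.of k)} (u : C ⟶ Y) {A B : Type u} [CommRing A]
    [Algebra k A] [CommRing B] [Algebra k B] (f : A →ₐ[k] B) (x : Points (u ≫ s) A) :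
    (x.map f).push u = (x.push u).map f :=
  Points.ext (Category.assoc _ _ _)

/-- A point fixed by an endomorphism of `K` is defined over any subfield containing the elements
fixed by it. -/
theorem Points.exists_map_val_eq {K : Type u} [Field K] [Algebra k K] (f : K →ₐ[k] K)
    (F : IntermediateField k K) (hF : ∀ z, f z = z → z ∈ F) (x : Points s K) (hx : x.map f = x) :
    ∃ y : Points s F, y.map F.val = x := by
  obtain ⟨p, φ, hφ⟩ := x.exists_eq_fromSpecResidueField
  have h1 : Spec.map (CommRingCat.ofHom f.toRingHom) ≫ x.1 = x.1 := congrArg Subtype.val hx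
  -- The inclusion of the residue field point is a monomorphism, so invariance says that `f` fixes
  -- the image of `φ`, which hence lies in `F`.
  rw [hφ, ← Category.assoc, ← Spec.map_comp, cancel_mono, Spec.map_inj] at h1
  let φ' : X.residueField p →+* F :=
    φ.hom.codRestrict F fun z => hF _ (congrArg (fun g => g.hom z) h1)
  have hφ' : CommRingCat.ofHom φ' ≫ CommRingCat.ofHom F.val.toRingHom = φ := by
    ext z
    rfl
  let y : Spec (CommRingCat.of F) ⟶ X :=
    Spec.map (CommRingCat.ofHom φ') ≫ X.fromSpecResidueField p
  have hy : Spec.map (CommRingCat.ofHom F.val.toRingHom) ≫ y = x.1 := by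
    rw [← Category.assoc, ← Spec.map_comp, hφ', hφ]
  refine ⟨⟨y, ?_⟩, Points.ext hy⟩
  obtain ⟨g, hg⟩ := Spec.map_surjective (y ≫ s)
  rw [← hg, Spec.map_inj]
  have h2 : Spec.map (CommRingCat.ofHom F.val.toRingHom) ≫ y ≫ s =
      Spec.map (CommRingCat.ofHom (algebraMap k K)) := by
    rw [← Category.assoc, hy, x.2]
  rw [← hg, ← Spec.map_comp, Spec.map_inj] at h2
  ext z
  exact congrArg (fun g => g.hom z) h2

end Maps

section Frobenius

variable {k : Type u} [Field k] [Fintype k] {K : Type u} [Field K] [Algebra k K]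
  {X C Y : Scheme.{u}} {s : X ⟶ Spec (CommRingCat.of k)}

theorem frobenius_injective : Function.Injective (frobenius : Points s K → Points s K) :=
  Points.map_injective _

theorem iterate_frobenius (n : ℕ) (P : Points s K) :
    frobenius^[n] P = P.map (FiniteField.frobeniusAlgHom k K ^ n) := by
  induction n with
  | zero => exact (Points.map_id P).symm
  | succ n ih =>
    rw [Function.iterate_succ_apply', ih, pow_succ']
    exact (Points.map_comp _ _ _).symm

theorem push_frobenius {s : Y ⟶ Spec (CommRingCat.of k)} (u : C ⟶ Y) (Q : Points (u ≫ s) K) :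
    (frobenius Q).push u = frobenius (Q.push u) :=
  Points.push_map u _ Q

theorem isDefinedOver_iff (n : ℕ) (P : Points s K) :
    IsDefinedOver n P ↔ frobenius^[n] P = P := by
  rw [iterate_frobenius]
  constructor
  · rintro ⟨x, rfl⟩
    rw [← Points.map_comp]
    congr 1
    ext z
    exact z.2
  · exact Points.exists_map_val_eq (FiniteField.frobeniusAlgHom k K ^ n) (finiteSubfield k K n)
      (fun z hz => hz) P

theorem numPoints_eq_card_fixed (s : X ⟶ Spec (CommRingCat.of k)) (n : ℕ) :
    numPoints K s n = Nat.card {P : Points s K // frobenius^[n] P = P} := by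
  refine Nat.card_congr (Equiv.ofBijective
    (fun x => ⟨x.map (finiteSubfield k K n).val, (isDefinedOver_iff n _).1 ⟨x, rfl⟩⟩) ⟨?_, ?_⟩)
  · intro x y h
    exact Points.map_injective _ (congrArg Subtype.val h)
  · rintro ⟨P, hP⟩
    obtain ⟨x, hx⟩ := (isDefinedOver_iff n P).2 hP
    exact ⟨x, Subtype.ext hx⟩

end Frobenius

end CurveZeta

/-! ### Normalization on points, over affine opens -/

namespace CurveZeta

section AffineLocal

variable {k : Type u} [Field k] {K : Type u} [Field K] [Algebra k K] {X C Y : Scheme.{u}}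

theorem exists_isAffineOpen_mem (x : X) : ∃ U : X.Opens, IsAffineOpen U ∧ x ∈ U := by
  obtain ⟨U, hU, hx, -⟩ := TopologicalSpace.Opens.isBasis_iff_nbhd.1 X.isBasis_affineOpens
    (U := ⊤) (x := x) trivial
  exact ⟨U, hU, hx⟩

/-- A field-valued point located in an affine open `U` is a homomorphism from the sections over
`U`. -/
theorem exists_map_comp_fromSpec_eq {U : X.Opens} (hU : IsAffineOpen U)
    (x : Spec (CommRingCat.of K) ⟶ X) (hx : x (IsLocalRing.closedPoint K) ∈ U) :
    ∃ φ : Γ(X, U) ⟶ CommRingCat.of K, Spec.map φ ≫ hU.fromSpec = x := by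
  have hr : Set.range x ⊆ Set.range hU.fromSpec := by
    rw [hU.range_fromSpec]
    rintro _ ⟨z, rfl⟩
    rwa [Subsingleton.elim (α := PrimeSpectrum K) z (IsLocalRing.closedPoint K)]
  obtain ⟨φ, hφ⟩ := Spec.map_surjective (IsOpenImmersion.lift hU.fromSpec x hr)
  exact ⟨φ, by rw [hφ, IsOpenImmersion.lift_fac]⟩

instance ker_isPrime {R : CommRingCat.{u}} (φ : R ⟶ CommRingCat.of K) :
    (RingHom.ker φ.hom).IsPrime :=
  RingHom.ker_isPrime (S := K) φ.hom

/-- The algebra structure is existentially quantified so that `x` may be only propositionally equal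
to the image of `y`. -/
theorem exists_isLocalization_stalk {U : X.Opens} (hU : IsAffineOpen U) {x : X}
    (y : PrimeSpectrum Γ(X, U)) (h : hU.fromSpec y = x) :
    ∃ _ : Algebra Γ(X, U) (X.presheaf.stalk x),
      IsLocalization.AtPrime (X.presheaf.stalk x) y.asIdeal := by
  subst h
  have hy : hU.fromSpec y ∈ U := hU.range_fromSpec.le ⟨y, rfl⟩
  exact ⟨_, hU.isLocalization_stalk' y hy⟩

theorem Points.exists_isLocalization_stalk {s : X ⟶ Spec (CommRingCat.of k)} {U : X.Opens}
    (hU : IsAffineOpen U) (P : Points s K) (φ : Γ(X, U) ⟶ CommRingCat.of K)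
    (hφ : Spec.map φ ≫ hU.fromSpec = P.1) :
    ∃ _ : Algebra Γ(X, U) (X.presheaf.stalk P.point),
      IsLocalization.AtPrime (X.presheaf.stalk P.point) (RingHom.ker φ.hom) := by
  have h : hU.fromSpec (Spec.map φ (IsLocalRing.closedPoint K)) = P.point := by
    rw [Points.point, ← hφ]
    rfl
  obtain ⟨alg, hloc⟩ := CurveZeta.exists_isLocalization_stalk hU _ h
  refine ⟨alg, ?_⟩
  have hker : (Spec.map φ (IsLocalRing.closedPoint K) : PrimeSpectrum Γ(X, U)).asIdeal =
      RingHom.ker φ.hom := by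
    change Ideal.comap φ.hom (IsLocalRing.maximalIdeal K) = _
    rw [IsLocalRing.maximalIdeal_eq_bot]
    rfl
  simpa only [hker] using hloc

theorem krullDimLE_one_of_isAffineOpen (hdim : topologicalKrullDim X ≤ 1) {U : X.Opens}
    (hU : IsAffineOpen U) : Ring.KrullDimLE 1 Γ(X, U) := by
  rw [Ring.krullDimLE_iff, ← PrimeSpectrum.topologicalKrullDim_eq_ringKrullDim]
  exact (hU.fromSpec.isOpenEmbedding.isInducing.topologicalKrullDim_le).trans hdim

theorem krullDimLE_one_of_isLocalization_atPrime {A Ap : Type*} [CommRing A] [CommRing Ap]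
    [Algebra A Ap] (p : Ideal A) [p.IsPrime] [IsLocalization.AtPrime Ap p]
    [hA : Ring.KrullDimLE 1 A] : Ring.KrullDimLE 1 Ap := by
  rw [Ring.krullDimLE_iff] at hA ⊢
  rw [IsLocalization.AtPrime.ringKrullDim_eq_height p Ap]
  exact Ideal.height_le_ringKrullDim_of_isPrime.trans hA

/-- The structure homomorphism of the sections over an affine open of a `k`-scheme. -/
theorem exists_ringHom_of_isAffineOpen (s : X ⟶ Spec (CommRingCat.of k)) {U : X.Opens}
    (hU : IsAffineOpen U) : ∃ g : k →+* Γ(X, U),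
      Spec.map (CommRingCat.ofHom g) = hU.fromSpec ≫ s ∧
      (LocallyOfFiniteType s → g.FiniteType) ∧
      ∀ φ : Γ(X, U) ⟶ CommRingCat.of K, (Spec.map φ ≫ hU.fromSpec) ≫ s =
        Spec.map (CommRingCat.ofHom (algebraMap k K)) ↔ φ.hom.comp g = algebraMap k K := by
  obtain ⟨g, hg⟩ := Spec.map_surjective (hU.fromSpec ≫ s)
  refine ⟨g.hom, hg, fun _ => ?_, fun φ => ?_⟩
  · rw [← HasRingHomProperty.Spec_iff (P := @LocallyOfFiniteType), hg]
    infer_instance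
  · rw [Category.assoc, ← hg, ← Spec.map_comp, Spec.map_inj]
    constructor
    · intro h
      exact congrArg CommRingCat.Hom.hom h
    · intro h
      ext z
      exact congrArg (fun f => f z) h

/-- By dominance the preimage of `U` contains the generic point of `C`. Both section rings embed in
stalks there, which `u` identifies, and the stalk of `Y` is a localization of `Γ(Y, U)`. -/
theorem IsNormalization.app_injective_and_birational [IsIntegral Y] {u : C ⟶ Y}
    (hu : IsNormalization u) {U : Y.Opens} (hU : IsAffineOpen U) (hne : (U : Set Y).Nonempty) :
    IsDomain Γ(C, u ⁻¹ᵁ U) ∧ Function.Injective (u.app U).hom ∧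
      ∀ b : Γ(C, u ⁻¹ᵁ U), ∃ t : Γ(Y, U), t ≠ 0 ∧ ∃ a : Γ(Y, U),
        (u.app U).hom t * b = (u.app U).hom a := by
  have := hu.isIntegral
  have := hu.isDominant
  have := hu.isIso_stalkMap_genericPoint
  obtain ⟨_, hcU, c, rfl⟩ := (u.denseRange).inter_open_nonempty U U.isOpen hne
  have hgC : genericPoint C ∈ u ⁻¹ᵁ U :=
    ((genericPoint_spec C).mem_open_set_iff (u ⁻¹ᵁ U).isOpen).2 ⟨c, trivial, hcU⟩
  have hg : u (genericPoint C) ∈ U := hgC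
  have hstalk : Function.Bijective (u.stalkMap (genericPoint C)) :=
    ConcreteCategory.bijective_of_isIso _
  have hinjY := germ_injective_of_isIntegral Y (u (genericPoint C)) hg
  have hinjC := germ_injective_of_isIntegral C (genericPoint C) hgC
  have hcomm := fun y => u.germ_stalkMap_apply U (genericPoint C) hg y
  refine ⟨@IsIntegral.component_integral _ _ (u ⁻¹ᵁ U) ⟨⟨_, hgC⟩⟩, fun x y hxy => ?_, fun b => ?_⟩
  · apply hinjY
    apply hstalk.1
    rw [hcomm, hcomm]
    exact congrArg _ hxy
  · obtain ⟨z, hz⟩ := hstalk.2 (C.presheaf.germ (u ⁻¹ᵁ U) (genericPoint C) hgC b)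
    let := Y.presheaf.algebra_section_stalk ⟨u (genericPoint C), hg⟩
    have := hU.isLocalization_stalk ⟨u (genericPoint C), hg⟩
    obtain ⟨⟨a, t⟩, hat⟩ := IsLocalization.surj
      (hU.primeIdealOf ⟨u (genericPoint C), hg⟩).asIdeal.primeCompl z
    refine ⟨t, fun h0 => t.2 (h0 ▸ Ideal.zero_mem _), a, ?_⟩
    apply hinjC
    have h1 := congrArg (u.stalkMap (genericPoint C)) hat
    change u.stalkMap (genericPoint C) (z * Y.presheaf.germ U _ hg t) =
      u.stalkMap (genericPoint C) (Y.presheaf.germ U _ hg a) at h1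
    rw [map_mul, hz, hcomm, hcomm, mul_comm] at h1
    rw [map_mul]
    exact h1

theorem push_surjective [IsAlgClosed K] [IsIntegral Y] {u : C ⟶ Y} (hu : IsNormalization u)
    (s : Y ⟶ Spec (CommRingCat.of k)) :
    Function.Surjective (Points.push u : Points (u ≫ s) K → Points s K) := by
  intro P
  have := hu.isIntegralHom
  obtain ⟨U, hU, hPU⟩ := exists_isAffineOpen_mem P.point
  obtain ⟨φ, hφ⟩ := exists_map_comp_fromSpec_eq hU P.1 hPU
  obtain ⟨-, hinj, -⟩ := hu.app_injective_and_birational hU ⟨_, hPU⟩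
  let := (u.app U).hom.toAlgebra
  have : FaithfulSMul Γ(Y, U) Γ(C, u ⁻¹ᵁ U) := (faithfulSMul_iff_algebraMap_injective _ _).2 hinj
  have : Algebra.IsIntegral Γ(Y, U) Γ(C, u ⁻¹ᵁ U) := ⟨u.isIntegral_app U hU⟩
  obtain ⟨ψ, hψ⟩ := RingHom.exists_comp_algebraMap_eq_of_isIntegral (B := Γ(C, u ⁻¹ᵁ U)) φ.hom
  have h : (Spec.map (CommRingCat.ofHom ψ) ≫ (hU.preimage u).fromSpec) ≫ u = P.1 := by
    rw [Category.assoc, ← IsAffineOpen.SpecMap_appLE_fromSpec u hU (hU.preimage u) le_rfl,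
      ← Category.assoc, ← Spec.map_comp, ← hφ, Scheme.Hom.appLE_eq_app]
    congr 2
    ext z
    exact congrArg (fun f => f z) hψ
  exact ⟨⟨_, by rw [← Category.assoc, h, P.2]⟩, Points.ext h⟩

/-- The points of the fibre above a point of an affine open `U`, in terms of homomorphisms. -/
theorem exists_comp_eq_of_push_eq (u : C ⟶ Y) [IsAffineHom u] {s : Y ⟶ Spec (CommRingCat.of k)}
    {U : Y.Opens} (hU : IsAffineOpen U) (P : Points s K) (φ : Γ(Y, U) ⟶ CommRingCat.of K)
    (hφ : Spec.map φ ≫ hU.fromSpec = P.1) (Q : Points (u ≫ s) K) (hQ : Q.push u = P) :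
    ∃ ψ : Γ(C, u ⁻¹ᵁ U) ⟶ CommRingCat.of K,
      Spec.map ψ ≫ (hU.preimage u).fromSpec = Q.1 ∧ ψ.hom.comp (u.app U).hom = φ.hom := by
  have hQP : Q.1 ≫ u = P.1 := congrArg Subtype.val hQ
  have hPU : P.1 (IsLocalRing.closedPoint K) ∈ U := by
    rw [← hφ]
    exact hU.range_fromSpec.le ⟨_, rfl⟩
  obtain ⟨ψ, hψ⟩ := exists_map_comp_fromSpec_eq (hU.preimage u) Q.1 (by
    rw [← hQP] at hPU
    exact hPU)
  refine ⟨ψ, hψ, ?_⟩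
  have h1 : Spec.map (u.app U ≫ ψ) ≫ hU.fromSpec = Spec.map φ ≫ hU.fromSpec := by
    rw [hφ, ← hQP, ← hψ, Category.assoc,
      ← IsAffineOpen.SpecMap_appLE_fromSpec u hU (hU.preimage u) le_rfl, ← Category.assoc,
      ← Spec.map_comp, Scheme.Hom.appLE_eq_app]
  rw [cancel_mono, Spec.map_inj] at h1
  exact congrArg CommRingCat.Hom.hom h1

theorem fibre_subsingleton_of_regular [IsIntegral Y] (hdim : topologicalKrullDim Y ≤ 1)
    {u : C ⟶ Y} (hu : IsNormalization u) {s : Y ⟶ Spec (CommRingCat.of k)} {P : Points s K}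
    (hP : P ∉ singularPoints s K) : (fibre u P).Subsingleton := by
  have hreg : IsRegularLocalRing (Y.presheaf.stalk P.point) := not_not.1 hP
  have := hu.isIntegralHom
  obtain ⟨U, hU, hPU⟩ := exists_isAffineOpen_mem P.point
  obtain ⟨φ, hφ⟩ := exists_map_comp_fromSpec_eq hU P.1 hPU
  obtain ⟨_, hinj, hb⟩ := hu.app_injective_and_birational hU ⟨_, hPU⟩
  let := (u.app U).hom.toAlgebra
  have : FaithfulSMul Γ(Y, U) Γ(C, u ⁻¹ᵁ U) := (faithfulSMul_iff_algebraMap_injective _ _).2 hinj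
  have : Algebra.IsIntegral Γ(Y, U) Γ(C, u ⁻¹ᵁ U) := ⟨u.isIntegral_app U hU⟩
  have : Nonempty U := ⟨⟨_, hPU⟩⟩
  have := krullDimLE_one_of_isAffineOpen hdim hU
  obtain ⟨_, hloc⟩ := Points.exists_isLocalization_stalk hU P φ hφ
  have : Ring.KrullDimLE 1 (Y.presheaf.stalk P.point) :=
    krullDimLE_one_of_isLocalization_atPrime (RingHom.ker φ.hom)
  have := isIntegrallyClosed_of_isRegularLocalRing (Y.presheaf.stalk P.point)
  intro Q₁ h₁ Q₂ h₂
  obtain ⟨ψ₁, hψ₁, hc₁⟩ := exists_comp_eq_of_push_eq u hU P φ hφ Q₁ h₁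
  obtain ⟨ψ₂, hψ₂, hc₂⟩ := exists_comp_eq_of_push_eq u hU P φ hφ Q₂ h₂
  have h := RingHom.eq_of_comp_algebraMap_eq_of_isIntegrallyClosed (A := Γ(Y, U))
    (B := Γ(C, u ⁻¹ᵁ U)) (K := K) (ψ₁ := ψ₁.hom) (ψ₂ := ψ₂.hom) hb (RingHom.ker φ.hom)
    (Y.presheaf.stalk P.point) (hc₁.trans hc₂.symm) (congrArg RingHom.ker hc₁)
  apply Points.ext
  rw [← hψ₁, ← hψ₂, CommRingCat.hom_ext h]

/-- If the kernel were zero, the stalk would be the fraction field of `Γ(Y, U)`, which is regular.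
The element `a` is what bounds the fibre over `P`. -/
theorem exists_ne_zero_mem_ker_of_singular [IsIntegral Y] {s : Y ⟶ Spec (CommRingCat.of k)}
    {P : Points s K} (hP : P ∈ singularPoints s K) {U : Y.Opens} (hU : IsAffineOpen U)
    (hPU : P.point ∈ U) (φ : Γ(Y, U) ⟶ CommRingCat.of K)
    (hφ : Spec.map φ ≫ hU.fromSpec = P.1) : ∃ a : Γ(Y, U), a ≠ 0 ∧ φ.hom a = 0 := by
  by_contra! h
  apply hP
  have : Nonempty U := ⟨⟨_, hPU⟩⟩
  obtain ⟨_, hloc⟩ := Points.exists_isLocalization_stalk hU P φ hφ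
  have hker : RingHom.ker φ.hom = ⊥ := (RingHom.ker φ.hom).eq_bot_iff.2 fun a ha => by
    by_contra h0
    exact h a h0 ha
  have hcompl : (RingHom.ker φ.hom).primeCompl = nonZeroDivisors Γ(Y, U) := by
    ext a
    rw [mem_nonZeroDivisors_iff_ne_zero, Ideal.mem_primeCompl_iff, hker, Ideal.mem_bot]
  have hfrac : IsFractionRing Γ(Y, U) (Y.presheaf.stalk P.point) := by
    unfold IsLocalization.AtPrime at hloc
    rwa [hcompl] at hloc
  let := IsFractionRing.toField Γ(Y, U) (K := Y.presheaf.stalk P.point)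
  infer_instance

/-- Points of the fibre are homomorphisms from `Γ(C, u ⁻¹ᵁ U)` that kill `a`, so they factor through
a quotient that is finite by Krull-Akizuki. -/
theorem finite_fibre_of_singular [Finite k] [IsIntegral Y] (hdim : topologicalKrullDim Y ≤ 1)
    {u : C ⟶ Y} (hu : IsNormalization u) {s : Y ⟶ Spec (CommRingCat.of k)}
    [LocallyOfFiniteType s] {P : Points s K} (hP : P ∈ singularPoints s K) :
    (fibre u P).Finite := by
  have := hu.isIntegralHom
  obtain ⟨U, hU, hPU⟩ := exists_isAffineOpen_mem P.point
  obtain ⟨φ, hφ⟩ := exists_map_comp_fromSpec_eq hU P.1 hPU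
  obtain ⟨_, hinj, hb⟩ := hu.app_injective_and_birational hU ⟨_, hPU⟩
  have : Nonempty U := ⟨⟨_, hPU⟩⟩
  have := krullDimLE_one_of_isAffineOpen hdim hU
  obtain ⟨a, ha, hφa⟩ := exists_ne_zero_mem_ker_of_singular hP hU hPU φ hφ
  obtain ⟨g, -, hft, hg⟩ := exists_ringHom_of_isAffineOpen (K := K) s hU
  let := (u.app U).hom.toAlgebra
  have : FaithfulSMul Γ(Y, U) Γ(C, u ⁻¹ᵁ U) := (faithfulSMul_iff_algebraMap_injective _ _).2 hinj
  let := g.toAlgebra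
  let : Algebra k Γ(C, u ⁻¹ᵁ U) := ((u.app U).hom.comp g).toAlgebra
  have : Algebra.FiniteType k Γ(Y, U) := hft inferInstance
  have hfin := finite_algHom_of_birational k (K := K) (A := Γ(Y, U)) (B := Γ(C, u ⁻¹ᵁ U)) hb ha
  have hφg : φ.hom.comp g = algebraMap k K := (hg φ).1 (by rw [hφ, P.2])
  refine (hfin.image fun ψ => Spec.map (CommRingCat.ofHom ψ.toRingHom) ≫
    (hU.preimage u).fromSpec).of_injOn (f := Subtype.val) ?_ Subtype.val_injective.injOn
  intro Q hQ
  obtain ⟨ψ, hψ, hc⟩ := exists_comp_eq_of_push_eq u hU P φ hφ Q hQ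
  let ψ' : Γ(C, u ⁻¹ᵁ U) →ₐ[k] K :=
    { ψ.hom with
      commutes' := fun z => by
        rw [← hφg, ← hc]
        rfl }
  refine ⟨ψ', ?_, hψ⟩
  change ψ.hom.comp (u.app U).hom a = 0
  rw [hc]
  exact hφa

theorem finite_of_forall_isAffineOpen [CompactSpace X] {s : X ⟶ Spec (CommRingCat.of k)}
    {Z : Set (Points s K)}
    (h : ∀ U : X.Opens, IsAffineOpen U → (Z ∩ {P | P.point ∈ U}).Finite) : Z.Finite := by
  choose U hU hx using fun x : X => exists_isAffineOpen_mem x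
  obtain ⟨t, ht⟩ := CompactSpace.elim_nhds_subcover (fun x => (U x : Set X))
    fun x => (U x).isOpen.mem_nhds (hx x)
  refine (t.finite_toSet.biUnion fun x _ => h (U x) (hU x)).subset fun P hP => ?_
  have : P.point ∈ ⋃ x ∈ t, (U x : Set X) := ht ▸ trivial
  obtain ⟨x, hxt, hPx⟩ := Set.mem_iUnion₂.1 this
  exact Set.mem_iUnion₂.2 ⟨x, hxt, hP, hPx⟩

/-- On an affine open, `h` from generic normality vanishes at every singular point, because normal
stalks are regular here. Only finitely many homomorphisms kill `h`. -/
theorem finite_singularPoints [Finite k] [IsIntegral Y] [CompactSpace Y]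
    (hdim : topologicalKrullDim Y ≤ 1) (s : Y ⟶ Spec (CommRingCat.of k))
    [LocallyOfFiniteType s] : (singularPoints s K).Finite := by
  refine finite_of_forall_isAffineOpen fun U hU => ?_
  rcases isEmpty_or_nonempty U with hE | _
  · exact Set.Finite.subset Set.finite_empty fun P hP => hE.elim ⟨_, hP.2⟩
  have := krullDimLE_one_of_isAffineOpen hdim hU
  obtain ⟨g, -, hft, hg⟩ := exists_ringHom_of_isAffineOpen (K := K) s hU
  let := g.toAlgebra
  have : Algebra.FiniteType k Γ(Y, U) := hft inferInstance
  have : IsNoetherianRing Γ(Y, U) := Algebra.FiniteType.isNoetherianRing k _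
  obtain ⟨h, h0, hreg⟩ := exists_forall_isIntegrallyClosed_localization k Γ(Y, U)
  have hfin := finite_algHom_of_birational k (K := K) (A := Γ(Y, U)) (B := Γ(Y, U))
    (fun b => ⟨1, one_ne_zero, b, by simp⟩) h0
  refine (hfin.image fun ψ => Spec.map (CommRingCat.ofHom ψ.toRingHom) ≫
    hU.fromSpec).of_injOn (f := Subtype.val) ?_ Subtype.val_injective.injOn
  rintro (P : Points s K) ⟨hP, hPU⟩
  obtain ⟨φ, hφ⟩ := exists_map_comp_fromSpec_eq hU P.1 hPU
  have hφg : φ.hom.comp g = algebraMap k K := (hg φ).1 (by rw [hφ, P.2])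
  let φ' : Γ(Y, U) →ₐ[k] K :=
    { φ.hom with
      commutes' := fun z => by
        rw [← hφg]
        rfl }
  refine ⟨φ', ?_, hφ⟩
  change φ.hom h = 0
  by_contra hne
  apply hP
  obtain ⟨_, hloc⟩ := Points.exists_isLocalization_stalk hU P φ hφ
  have : Ring.KrullDimLE 1 (Y.presheaf.stalk P.point) :=
    krullDimLE_one_of_isLocalization_atPrime (RingHom.ker φ.hom)
  have := hreg (RingHom.ker φ.hom) hne (Y.presheaf.stalk P.point)
  have : IsNoetherianRing (Y.presheaf.stalk P.point) :=
    IsLocalization.isNoetherianRing (RingHom.ker φ.hom).primeCompl _ inferInstance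
  exact isRegularLocalRing_of_isIntegrallyClosed _

theorem finite_points [Finite K] [CompactSpace X] (s : X ⟶ Spec (CommRingCat.of k))
    [LocallyOfFiniteType s] : Finite (Points s K) := by
  rw [← Set.finite_univ_iff]
  refine finite_of_forall_isAffineOpen fun U hU => ?_
  obtain ⟨g, -, hft, hg⟩ := exists_ringHom_of_isAffineOpen (K := K) s hU
  let := g.toAlgebra
  have hfin : Algebra.FiniteType k Γ(X, U) := hft inferInstance
  obtain ⟨S, hS⟩ := hfin.out
  have : Finite (Γ(X, U) →ₐ[k] K) := by
    refine Finite.of_injective (fun (φ : Γ(X, U) →ₐ[k] K) (z : S) => φ z) fun φ ψ h => ?_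
    exact AlgHom.ext_of_adjoin_eq_top hS fun z hz => congrFun h ⟨z, hz⟩
  refine ((Set.finite_range fun φ : Γ(X, U) →ₐ[k] K => Spec.map (CommRingCat.ofHom φ.toRingHom) ≫
    hU.fromSpec)).of_injOn (f := Subtype.val) ?_ Subtype.val_injective.injOn
  rintro (P : Points s K) ⟨-, hPU⟩
  obtain ⟨φ, hφ⟩ := exists_map_comp_fromSpec_eq hU P.1 hPU
  have hφg : φ.hom.comp g = algebraMap k K := (hg φ).1 (by rw [hφ, P.2])
  exact ⟨{ φ.hom with
      commutes' := fun z => by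
        rw [← hφg]
        rfl }, hφ⟩

end AffineLocal

end CurveZeta

/-! ### Reduction of the point counts to finite stable subsets -/

section FiniteSubset

variable {α β : Type*} {f : α → α} {g : β → β} {p : α → β}

/-- The permutation induced by an injective map on a finite stable subset. -/
noncomputable def Function.Injective.permOfFinite (hf : Function.Injective f) {S : Set α}
    (hS : S.Finite) (hfS : ∀ x ∈ S, f x ∈ S) : Equiv.Perm S :=
  have := hS.to_subtype
  Equiv.ofBijective (fun x => ⟨f x, hfS x x.2⟩)
    (Finite.injective_iff_bijective.1 fun _ _ h => Subtype.ext (hf (congrArg Subtype.val h)))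

theorem Function.Injective.coe_permOfFinite_pow (hf : Function.Injective f) {S : Set α}
    (hS : S.Finite) (hfS : ∀ x ∈ S, f x ∈ S) (n : ℕ) (x : S) :
    (((hf.permOfFinite hS hfS) ^ n) x : α) = f^[n] x := by
  induction n generalizing x with
  | zero => rfl
  | succ n ih => rw [pow_succ, Equiv.Perm.mul_apply, ih]; rfl

theorem Function.Injective.card_fixed_permOfFinite (hf : Function.Injective f) {S : Set α}
    (hS : S.Finite) (hfS : ∀ x ∈ S, f x ∈ S) (n : ℕ) :
    Nat.card {x : S // ((hf.permOfFinite hS hfS) ^ n) x = x} =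
      ({x | f^[n] x = x} ∩ S).ncard := by
  rw [← Nat.card_coe_set_eq]
  refine Nat.card_congr ⟨fun x => ⟨x.1.1, ?_, x.1.2⟩, fun x => ⟨⟨x.1, x.2.2⟩, ?_⟩,
    fun _ => rfl, fun _ => rfl⟩
  · rw [Set.mem_ofPred_eq, ← hf.coe_permOfFinite_pow hS hfS, x.2]
  · apply Subtype.ext
    rw [hf.coe_permOfFinite_pow hS hfS]
    exact x.2.1

variable (hpfg : ∀ x, p (f x) = g (p x))
include hpfg

theorem map_iterate_apply (n : ℕ) (x : α) : p (f^[n] x) = g^[n] (p x) :=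
  Function.Semiconj.iterate_right hpfg n x

/-- If `p` is bijective away from the finite sets `p ⁻¹' S` and `S`, the differences of the numbers
of fixed points are concentrated on these sets. -/
theorem ncard_fixed_add_ncard_fixed (hp : Function.Surjective p) {S : Set β}
    (hT : (p ⁻¹' S).Finite) (hsub : ∀ y ∉ S, (p ⁻¹' {y}).Subsingleton) {n : ℕ}
    (hfin : {y | g^[n] y = y}.Finite) :
    {y | g^[n] y = y}.ncard + ({x | f^[n] x = x} ∩ p ⁻¹' S).ncard =
      {x | f^[n] x = x}.ncard + ({y | g^[n] y = y} ∩ S).ncard := by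
  have hbij : Set.BijOn p ({x | f^[n] x = x} \ p ⁻¹' S) ({y | g^[n] y = y} \ S) := by
    refine ⟨fun x hx => ⟨?_, hx.2⟩, fun x hx y hy hxy => ?_, fun y hy => ?_⟩
    · rw [Set.mem_ofPred_eq, ← map_iterate_apply hpfg, hx.1]
    · exact hsub (p x) hx.2 rfl hxy.symm
    · obtain ⟨x, rfl⟩ := hp y
      -- Above a fixed point outside `S`, `x` and its `n`-th iterate lie in the same one-point
      -- fibre, so `x` is fixed too.
      refine ⟨x, ⟨hsub (p x) hy.2 ?_ rfl, hy.2⟩, rfl⟩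
      rw [Set.mem_preimage, map_iterate_apply hpfg]
      exact hy.1
  have hfin' : {x | f^[n] x = x}.Finite := by
    rw [← Set.inter_union_sdiff {x | f^[n] x = x} (p ⁻¹' S)]
    exact (hT.subset Set.inter_subset_right).union
      (hbij.finite_iff_finite.2 (hfin.subset Set.sdiff_subset))
  have h1 := Set.ncard_inter_add_ncard_sdiff_eq_ncard {y | g^[n] y = y} S hfin
  have h2 := Set.ncard_inter_add_ncard_sdiff_eq_ncard {x | f^[n] x = x} (p ⁻¹' S) hfin'
  have h3 : ({x | f^[n] x = x} \ p ⁻¹' S).ncard = ({y | g^[n] y = y} \ S).ncard := by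
    rw [← hbij.image_eq, Set.InjOn.ncard_image hbij.injOn]
  omega

open Polynomial in
theorem exists_polynomial_mul_exp_eq_exp (hf : Function.Injective f) (hg : Function.Injective g)
    (hp : Function.Surjective p) {S : Set β} (hS : S.Finite) (hgS : ∀ y, g y ∈ S ↔ y ∈ S)
    (hT : (p ⁻¹' S).Finite) (hsub : ∀ y ∉ S, (p ⁻¹' {y}).Subsingleton)
    (hfin : ∀ n ≠ 0, {y | g^[n] y = y}.Finite) :
    ∃ L : ℚ[X],
      (L : PowerSeries ℚ) * (PowerSeries.exp ℚ).subst
          (PowerSeries.mk fun n : ℕ => (Nat.card {x // f^[n] x = x} : ℚ) / (n : ℚ)) =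
        (PowerSeries.exp ℚ).subst
          (PowerSeries.mk fun n : ℕ => (Nat.card {y // g^[n] y = y} : ℚ) / (n : ℚ)) ∧
      L.natDegree + S.ncard = (p ⁻¹' S).ncard ∧
      ((∀ z : ℂ, z ≠ 0 → aeval z L = 0 → z = -1) ↔ ∀ y ∈ S, (∃ x, p ⁻¹' {y} = {x}) ∨
        (g y = y ∧ ∃ x x', x ≠ x' ∧ p ⁻¹' {y} = {x, x'} ∧ f x = x' ∧ f x' = x)) := by
  have hgS' : ∀ y ∈ S, g y ∈ S := fun y => (hgS y).2
  have hfT : ∀ x ∈ p ⁻¹' S, f x ∈ p ⁻¹' S := fun x hx => by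
    rw [Set.mem_preimage, hpfg]
    exact hgS' _ hx
  let σ := hg.permOfFinite hS hgS'
  let τ := hf.permOfFinite hT hfT
  let p' : p ⁻¹' S → S := fun x => ⟨p x, x.2⟩
  have hp' : ∀ x, p' (τ x) = σ (p' x) := fun x => Subtype.ext (hpfg x)
  have hsurj : Function.Surjective p' := by
    rintro ⟨y, hy⟩
    obtain ⟨x, rfl⟩ := hp y
    exact ⟨⟨x, hy⟩, rfl⟩
  let := hS.fintype
  let := hT.fintype
  obtain ⟨L, hL, hdeg, hroot⟩ := Equiv.Perm.exists_quotient_orbitPolynomial hp' hsurj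
  refine ⟨L, ?_, ?_, ?_⟩
  · have hσ := Equiv.Perm.exp_subst_card_fixed_mul_orbitPolynomial σ
    have hτ := Equiv.Perm.exp_subst_card_fixed_mul_orbitPolynomial τ
    simp only [σ, τ, Function.Injective.card_fixed_permOfFinite] at hσ hτ
    rw [← hL, Polynomial.coe_mul] at hτ
    have hc : ∀ a : ℕ → ℕ, PowerSeries.constantCoeff
        (PowerSeries.mk fun n : ℕ => (a n : ℚ) / (n : ℚ)) = 0 := fun a => by
      simp [← PowerSeries.coeff_zero_eq_constantCoeff_apply]
    have hadd : (PowerSeries.mk fun n : ℕ => (Nat.card {y // g^[n] y = y} : ℚ) / (n : ℚ)) +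
        (PowerSeries.mk fun n : ℕ => (({x | f^[n] x = x} ∩ p ⁻¹' S).ncard : ℚ) / (n : ℚ)) =
        (PowerSeries.mk fun n : ℕ => (Nat.card {x // f^[n] x = x} : ℚ) / (n : ℚ)) +
        (PowerSeries.mk fun n : ℕ => (({y | g^[n] y = y} ∩ S).ncard : ℚ) / (n : ℚ)) := by
      ext n
      simp only [map_add, PowerSeries.coeff_mk]
      -- For `n = 0` every point is fixed and the counts need not be finite, but division by `0`
      -- makes the coefficient `0`.
      rcases eq_or_ne n 0 with rfl | hn
      · simp
      · have h := ncard_fixed_add_ncard_fixed hpfg hp hT hsub (hfin n hn)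
        rw [← add_div, ← add_div]
        congr 1
        exact_mod_cast h
    have hexp := congrArg (PowerSeries.exp ℚ).subst hadd
    rw [PowerSeries.exp_subst_add (hc _) (hc _), PowerSeries.exp_subst_add (hc _) (hc _)] at hexp
    -- With `Z_S`, `Z_T` the series of the finite sets and `P` the orbit polynomial of `σ`, the
    -- inputs are `Z_Y Z_T = Z_C Z_S`, `Z_S P = 1` and `Z_T L P = 1`.
    linear_combination (-(L : PowerSeries ℚ) * (Equiv.Perm.orbitPolynomial σ : PowerSeries ℚ)) *
      hexp - ((L : PowerSeries ℚ) * (PowerSeries.exp ℚ).subst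
        (PowerSeries.mk fun n : ℕ => (Nat.card {x // f^[n] x = x} : ℚ) / (n : ℚ))) * hσ +
      ((PowerSeries.exp ℚ).subst
        (PowerSeries.mk fun n : ℕ => (Nat.card {y // g^[n] y = y} : ℚ) / (n : ℚ))) * hτ
  · rw [← Nat.card_coe_set_eq, ← Nat.card_coe_set_eq, Nat.card_eq_fintype_card,
      Nat.card_eq_fintype_card]
    exact hdeg
  · rw [hroot]
    constructor
    · intro h y hy
      have himg : p ⁻¹' {y} = Subtype.val '' (p' ⁻¹' {⟨y, hy⟩}) := by
        ext x
        constructor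
        · intro hx
          have hx' : p x = y := hx
          exact ⟨⟨x, by rw [Set.mem_preimage, hx']; exact hy⟩, Subtype.ext hx', rfl⟩
        · rintro ⟨x, hx, rfl⟩
          exact congrArg Subtype.val hx
      rcases h ⟨y, hy⟩ with ⟨x, hx⟩ | ⟨hy', x, x', hne, hxx, h1, h2⟩
      · exact .inl ⟨x, by rw [himg, hx, Set.image_singleton]⟩
      · exact .inr ⟨congrArg Subtype.val hy', x, x', fun h => hne (Subtype.ext h),
          by rw [himg, hxx, Set.image_pair], congrArg Subtype.val h1, congrArg Subtype.val h2⟩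
    · rintro h ⟨y, hy⟩
      have hmem : ∀ x ∈ p ⁻¹' {y}, x ∈ p ⁻¹' S := fun x hx => by
        rw [Set.mem_preimage, show p x = y from hx]
        exact hy
      have hpre : p' ⁻¹' {⟨y, hy⟩} = Subtype.val ⁻¹' (p ⁻¹' {y}) := by
        ext x
        exact Subtype.ext_iff
      rcases h y hy with ⟨x, hx⟩ | ⟨hy', x, x', hne, hxx, h1, h2⟩
      · have hxS := hmem x (hx.ge rfl)
        refine .inl ⟨⟨x, hxS⟩, ?_⟩
        ext z
        rw [hpre, hx, Set.mem_preimage, Set.mem_singleton_iff, Set.mem_singleton_iff,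
          Subtype.ext_iff]
      · have hxS := hmem x (hxx.ge (.inl rfl))
        have hxS' := hmem x' (hxx.ge (.inr rfl))
        refine .inr ⟨Subtype.ext hy', ⟨x, hxS⟩, ⟨x', hxS'⟩, fun h => hne (congrArg Subtype.val h),
          ?_, Subtype.ext h1, Subtype.ext h2⟩
        ext z
        rw [hpre, hxx]
        simp only [Set.mem_preimage, Set.mem_insert_iff, Set.mem_singleton_iff, Subtype.ext_iff]

end FiniteSubset

/-! ### Projective schemes and finiteness of rational points -/

namespace CurveZeta

section Projective

attribute [local instance] MvPolynomial.gradedAlgebra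

variable {k : Type u} [Field k] {X : Scheme.{u}}

theorem finiteType_algebraMap_homogeneousSubmodule_zero (n : ℕ) :
    (algebraMap k (MvPolynomial.homogeneousSubmodule (Fin (n + 1)) k 0)).FiniteType := by
  apply RingHom.FiniteType.of_surjective
  rintro ⟨x, hx⟩
  rw [MvPolynomial.homogeneousSubmodule_zero] at hx
  obtain ⟨c, hc⟩ := Submodule.mem_one.1 hx
  exact ⟨c, Subtype.ext hc⟩

/-- Local finite type and quasi-compactness are the two consequences of projectivity used in the
proof. -/
theorem projectiveSpace_finiteType (k : Type u) [Field k] (n : ℕ) :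
    LocallyOfFiniteType (projectiveSpaceToSpec k n) ∧ CompactSpace (projectiveSpace k n) := by
  have : Algebra.FiniteType (MvPolynomial.homogeneousSubmodule (Fin (n + 1)) k 0)
      (MvPolynomial (Fin (n + 1)) k) := by
    have h : (algebraMap k (MvPolynomial (Fin (n + 1)) k)).FiniteType :=
      RingHom.finiteType_algebraMap.2 inferInstance
    exact RingHom.finiteType_algebraMap.1 (RingHom.FiniteType.of_comp_finiteType
      (f := algebraMap k (MvPolynomial.homogeneousSubmodule (Fin (n + 1)) k 0)) h)
  have : LocallyOfFiniteType (Spec.map (CommRingCat.ofHom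
      (algebraMap k (MvPolynomial.homogeneousSubmodule (Fin (n + 1)) k 0)))) :=
    HasRingHomProperty.Spec_iff.2 (finiteType_algebraMap_homogeneousSubmodule_zero n)
  refine ⟨?_, ?_⟩
  · unfold projectiveSpaceToSpec projectiveSpace
    infer_instance
  · exact (quasiCompact_iff_compactSpace
      (f := Proj.toSpecZero (MvPolynomial.homogeneousSubmodule (Fin (n + 1)) k))).1 inferInstance

theorem IsProjective.locallyOfFiniteType {s : X ⟶ Spec (CommRingCat.of k)} (h : IsProjective s) :
    LocallyOfFiniteType s := by
  obtain ⟨n, i, _, rfl⟩ := h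
  have := (projectiveSpace_finiteType k n).1
  infer_instance

theorem IsProjective.compactSpace {s : X ⟶ Spec (CommRingCat.of k)} (h : IsProjective s) :
    CompactSpace X := by
  obtain ⟨n, i, _, -⟩ := h
  have := (projectiveSpace_finiteType k n).2
  exact i.isClosedEmbedding.compactSpace

end Projective

section FrobeniusPoints

variable {k : Type u} [Field k] [Fintype k] {K : Type u} [Field K] [Algebra k K]
  {X : Scheme.{u}} {s : X ⟶ Spec (CommRingCat.of k)}

/-- `Spec K` has a single point, so Frobenius moves `K`-points without moving their location. This
makes the singular points stable. -/
theorem frobenius_point (P : Points s K) : (frobenius P).point = P.point := by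
  change P.1 (Spec.map (CommRingCat.ofHom (FiniteField.frobeniusAlgHom k K).toRingHom)
    (IsLocalRing.closedPoint K)) = P.1 (IsLocalRing.closedPoint K)
  congr 1
  exact Subsingleton.elim (α := PrimeSpectrum K) _ _

theorem frobenius_mem_singularPoints (P : Points s K) :
    frobenius P ∈ singularPoints s K ↔ P ∈ singularPoints s K := by
  change ¬ IsRegularLocalRing (X.presheaf.stalk (frobenius P).point) ↔
    ¬ IsRegularLocalRing (X.presheaf.stalk P.point)
  rw [frobenius_point]

theorem finite_finiteSubfield {n : ℕ} (hn : n ≠ 0) : Finite (finiteSubfield k K n) := by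
  classical
  have hq : 1 < Fintype.card k ^ n := Nat.one_lt_pow hn Fintype.one_lt_card
  have h0 : (Polynomial.X ^ (Fintype.card k ^ n) - Polynomial.X : Polynomial K) ≠ 0 :=
    FiniteField.X_pow_card_sub_X_ne_zero K hq
  refine Set.Finite.to_subtype (((Polynomial.X ^ (Fintype.card k ^ n) - Polynomial.X :
    Polynomial K).roots.toFinset.finite_toSet).subset fun x hx => ?_)
  rw [Finset.mem_coe, Multiset.mem_toFinset, Polynomial.mem_roots h0]
  simp [(mem_finiteSubfield k K n x).1 hx]

theorem finite_fixed_frobenius [CompactSpace X] [LocallyOfFiniteType s] {n : ℕ} (hn : n ≠ 0) :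
    {P : Points s K | frobenius^[n] P = P}.Finite := by
  have := finite_finiteSubfield (k := k) (K := K) hn
  have := finite_points (K := finiteSubfield k K n) s
  refine (Set.finite_range fun x : Points s (finiteSubfield k K n) =>
    x.map (finiteSubfield k K n).val).subset fun P hP => ?_
  exact (isDefinedOver_iff n P).2 hP

end FrobeniusPoints

theorem forall_isInverseRoot_iff (L : Polynomial ℚ) :
    (∀ β : ℂ, IsInverseRoot L β → β = -1) ↔
      ∀ z : ℂ, z ≠ 0 → Polynomial.aeval z L = 0 → z = -1 := by
  constructor
  · intro h z hz hzL
    have := h z⁻¹ ⟨inv_ne_zero hz, by rwa [inv_inv]⟩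
    rw [← inv_inv z, this, inv_neg_one]
  · rintro h β ⟨hβ, hβL⟩
    rw [← inv_inv β, h β⁻¹ (inv_ne_zero hβ) hβL, inv_neg_one]

end CurveZeta

/-! ### The main theorem -/

theorem lemmae0 {k : Type u} [Field k] [Fintype k]
    (K : Type u) [Field K] [Algebra k K] [IsAlgClosure k K]
    {Y C : Scheme.{u}} (s : Y ⟶ Spec (CommRingCat.of k))
    (hproj : CurveZeta.IsProjective s) (hint : GeometricallyIntegral s)
    (hdim : topologicalKrullDim Y = 1)
    (u : C ⟶ Y) (hu : CurveZeta.IsNormalization u) :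
    ∃ L : Polynomial ℚ,
      (L : PowerSeries ℚ) * CurveZeta.zeta K (u ≫ s) = CurveZeta.zeta K s ∧
      (L.natDegree : ℤ) = CurveZeta.delta u s K ∧
      ((∀ β : ℂ, CurveZeta.IsInverseRoot L β → β = -1) ↔
        ∀ P ∈ CurveZeta.singularPoints s K,
          (CurveZeta.fibre u P).ncard = 1 ∨
          (CurveZeta.IsDefinedOver 1 P ∧
            ∃ Q Q' : CurveZeta.Points (u ≫ s) K,
              Q ≠ Q' ∧ CurveZeta.fibre u P = {Q, Q'} ∧
              CurveZeta.frobenius Q = Q' ∧ CurveZeta.frobenius Q' = Q ∧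
              CurveZeta.IsDefinedOver 2 Q ∧ ¬ CurveZeta.IsDefinedOver 1 Q ∧
              CurveZeta.IsDefinedOver 2 Q' ∧ ¬ CurveZeta.IsDefinedOver 1 Q')) := by
  have : IsAlgClosed K := IsAlgClosure.isAlgClosed k
  have := hproj.locallyOfFiniteType
  have := hproj.compactSpace
  have : Subsingleton (Spec (CommRingCat.of k)) :=
    inferInstanceAs (Subsingleton (PrimeSpectrum k))
  have : IsDomain (CommRingCat.of k) := inferInstanceAs (IsDomain k)
  have : IsIntegral Y := GeometricallyIntegral.isIntegral_of_subsingleton s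
  have hS : (CurveZeta.singularPoints s K).Finite := CurveZeta.finite_singularPoints hdim.le s
  have hT : (CurveZeta.Points.push u ⁻¹' CurveZeta.singularPoints s K).Finite :=
    hS.preimage' fun P hP => CurveZeta.finite_fibre_of_singular hdim.le hu hP
  obtain ⟨L, hL, hdeg, hroot⟩ := exists_polynomial_mul_exp_eq_exp
    (CurveZeta.push_frobenius (K := K) (s := s) u) CurveZeta.frobenius_injective
    CurveZeta.frobenius_injective (CurveZeta.push_surjective hu s) hS
    CurveZeta.frobenius_mem_singularPoints hT
    (fun P hP => CurveZeta.fibre_subsingleton_of_regular hdim.le hu hP)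
    (fun n hn => CurveZeta.finite_fixed_frobenius hn)
  refine ⟨L, ?_, ?_, ?_⟩
  · simp only [CurveZeta.zeta, CurveZeta.numPoints_eq_card_fixed]
    exact hL
  · rw [CurveZeta.delta, ← hdeg]
    push_cast
    ring
  · rw [CurveZeta.forall_isInverseRoot_iff, hroot]
    refine forall₂_congr fun P hP => or_congr Set.ncard_eq_one.symm (and_congr ?_ ?_)
    · rw [CurveZeta.isDefinedOver_iff, Function.iterate_one]
    · refine exists₂_congr fun Q Q' => and_congr_right fun hne => and_congr_right fun _ =>
        and_congr_right fun h1 => ⟨fun h2 => ⟨h2, ?_⟩, fun h => h.1⟩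
      -- The field of definition conditions in (b) follow from the exchange: two distinct exchanged
      -- points are fixed by the square of Frobenius but not by Frobenius.
      simp only [CurveZeta.isDefinedOver_iff, Function.iterate_succ, Function.iterate_zero,
        Function.comp_apply, id_eq, h1, h2, true_and]
      exact ⟨hne.symm, hne⟩
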